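/- Let $m,N\ge 1$, let $q\in\mathbb C$ with $0<|q|<1$, and let $\lambda\in\mathbb C$. Let $B_\infty,B_1,\dots,B_N\in \mathrm M_m(\mathbb C)$, let $b_1,\dots,b_N\in\mathbb C\setminus\{0\}$ be pairwise distinct, and consider the equation $$E:\ Y(qx)=B(x)Y(x),\qquad B(x)=B_\infty+\sum_{i=1}^N\frac{B_i}{1-x/b_i}.$$ Put $B_0=1_m-B_\infty-\sum_{i=1}^N B_i$, $T(x)=\prod_{i=1}^N(1-x/b_i)$, $b_\infty=\prod_{i=1}^N(-b_i^{-1})$ and $A(x)=T(x)B(x)=\sum_{k=0}^N A_kx^k$, $A_\infty=A_N$. Assume that $E$ is of Fuchsian type, i.e. $A_0$ and $A_\infty$ are invertible, and that for all $i\in\{0,\dots,N\}$ and all $\tau\in\mathbb C$ $$(\ast)\ \bigcap_{j\ne i}\ker B_j\cap\ker(B_i+\tau 1_m)=0,\qquad (\ast\ast)\ \sum_{j\ne i}\operatorname{im}B_j+\operatorname{im}(B_i+\tau 1_m)=\mathbb C^m .$$ The $q$-convolution $c_\lambda(E)$ is the equation of size $(N+1)m$ of the same form, with the same points $b_i$ and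 with the matrices $F_\infty,F_1,\dots,F_N$ in place of $B_\infty,B_1,\dots,B_N$: in $m\times m$ blocks numbered from $0$ to $N$, the matrix $F_i$ has block row number $i$ equal to $(B_0,\dots,B_i-(1-q^\lambda)1_m,\dots,B_N)$ and all its other block rows zero, and $F_\infty=1_{(N+1)m}-\widehat F$, where every block row of $\widehat F$ is $(B_0,\dots,B_N)$. Let $G(x)=T(x)\bigl(F_\infty+\sum_{i=1}^N \frac{F_i}{1-x/b_i}\bigr)=\sum_{k=0}^NG_kx^k$ and $G_\infty=G_N$. The spectral type $S(E)=(S_0;S_\infty;S_{\mathrm{div}})$ is defined as follows. For $\xi\in\{0,\infty\}$, $S_\xi$ assigns to each eigenvalue $\alpha$ of $A_\xi$ the partition conjugate to the partition formed by the sizes of the Jordan cells of $A_\xi$ with eigenvalue $\alpha$. Let $\operatorname{diag}(d_1,\dots,d_m)$ with $d_{i+1}\mid d_i$ be the Smith normal form of $A(x)$ over $\mathbb C[x]$ and $Z_A=\{a\in\mathbb C:\det A(a)=0\}$; then $S_{\mathrm{div}}$ assigns to each $a\in Z_A$ the partition conjugate to that of the orders of vanishing of $d_1,\dots,d_m$ at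 $a$. The spectral type of $c_\lambda(E)$ is defined in the same way from $G_0$, $G_\infty$ and $G(x)$. Then $c_\lambda(E)$ is again of Fuchsian type, $G(a)\neq0$ for all $a\in\mathbb C$, and the spectral type $(S_0';S_\infty';S_{\mathrm{div}}')$ of $c_\lambda(E)$ is obtained from $(S_0;S_\infty;S_{\mathrm{div}})$ as follows. * $S_0'$: if $q^\lambda$ is an eigenvalue of $A_0$, the part $Nm$ is put in front of the partition of $q^\lambda$; otherwise the new eigenvalue $q^\lambda$ with the partition $(Nm)$ is added. All other eigenvalues keep their partitions. * $S_\infty'$: if $b_\infty$ is an eigenvalue of $A_\infty$, the part $Nm$ is put in front of the partition of $b_\infty$; otherwise the new eigenvalue $b_\infty$ with the partition $(Nm)$ is added. All other eigenvalues keep their partitions. * $S_{\mathrm{div}}'$: the zeros of $\det G$ are the points $q^\lambda a$ with $a\in Z_A$, together with the points $b_k\notin q^\lambda Z_A$. A point $b_k\notin q^\lambda Z_A$ has the partition $(Nm)$. A point $q^\lambda a$ with $a\in Z_A$ has the partition of $a$ in $S_{\mathrm{div}}$, preceded by the part $Nm$ if $q^\lambda a\in\{b_1,\dots,b_N\}$,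 and unchanged otherwise. -/

import Mathlib

open Polynomial

noncomputable section

namespace QDiff

/-! ### The equations `σ_x Y = B(x) Y` and the `q`-convolution -/

/-- The data of an equation `E_{B,b} : Y(q x) = B(x) Y(x)`,
`B(x) = B_∞ + ∑ i, B_i / (1 - x / b_i)`, with square matrices indexed by `n` and
pairwise distinct nonzero points `b_1, …, b_N`. -/
structure System (n : Type) (N : ℕ) where
  Binf : Matrix n n ℂ
  B : Fin N → Matrix n n ℂ
  b : Fin N → ℂ
  b_ne_zero : ∀ i, b i ≠ 0
  b_injective : Function.Injective b

namespace System

variable {n : Type} [Fintype n] [DecidableEq n] {N : ℕ}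

/-- `B_0 = 1 - B_∞ - ∑ i, B_i`. -/
def B0 (E : System n N) : Matrix n n ℂ := 1 - E.Binf - ∑ i, E.B i

/-- The tuple `B_0, B_1, …, B_N`. -/
def res (E : System n N) : Fin (N + 1) → Matrix n n ℂ := Fin.cons E.B0 E.B

/-- The matrix `B(x)`, at a point `x` different from all the `b_i`. -/
def rat (E : System n N) (x : ℂ) : Matrix n n ℂ :=
  E.Binf + ∑ i, (1 - x / E.b i)⁻¹ • E.B i

/-- `T(x) = ∏ i, (1 - x / b_i)`. -/
def T (E : System n N) : ℂ[X] := ∏ i, (1 - C (E.b i)⁻¹ * X)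

/-- `b_∞ = ∏ i, (- b_i⁻¹)`. -/
def binf (E : System n N) : ℂ := ∏ i, (-(E.b i)⁻¹)

/-- The coefficient polynomial `A(x) = T(x) B(x)` of the canonical form. -/
def A (E : System n N) : Matrix n n ℂ[X] :=
  E.T • E.Binf.map C +
    ∑ i, (∏ j ∈ Finset.univ.erase i, (1 - C (E.b j)⁻¹ * X)) • (E.B i).map C

/-- `A(x) = T(x) B(x)` away from the points `b_i`. -/
theorem eval_A {κ : Type} {M : ℕ} (E : System κ M) (x : ℂ) (hx : ∀ i, x ≠ E.b i) :
    E.A.map (eval x) = E.T.eval x • E.rat x := by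
  have h1 : ∀ i, (1 - x / E.b i) ≠ 0 := fun i h => hx i (by
    have h2 := E.b_ne_zero i
    field_simp at h
    linear_combination -h)
  ext u v
  simp only [A, rat, T, Matrix.map_apply, Matrix.add_apply, Matrix.smul_apply, Matrix.sum_apply,
    smul_eq_mul, eval_add, eval_mul, eval_finsetSum, eval_C, mul_add, Finset.mul_sum, eval_prod,
    eval_sub, eval_one, eval_X]
  congr 1
  refine Finset.sum_congr rfl fun i _ => ?_
  rw [← Finset.mul_prod_erase Finset.univ _ (Finset.mem_univ i)]
  have h2 := h1 i
  have h3 : (E.b i)⁻¹ * x = x / E.b i := by ring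
  rw [h3]
  generalize 1 - x / E.b i = w at h2
  field_simp

/-- `A_0`, the constant coefficient of `A(x)`. -/
def Azero (E : System n N) : Matrix n n ℂ := E.A.map fun p => p.coeff 0

/-- `A_∞ = A_N`, the coefficient of `x ^ N` in `A(x)`. -/
def Ainf (E : System n N) : Matrix n n ℂ := E.A.map fun p => p.coeff N

/-- The equation is of Fuchsian type: `A_0` and `A_∞` are invertible. -/
def IsFuchsian (E : System n N) : Prop := IsUnit E.Azero ∧ IsUnit E.Ainf

/-- The condition `(∗)`. -/
def Star (E : System n N) : Prop :=
  ∀ (i : Fin (N + 1)) (τ : ℂ),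
    (⨅ j : Fin (N + 1), ⨅ _ : j ≠ i, LinearMap.ker (E.res j).mulVecLin) ⊓
      LinearMap.ker (E.res i + τ • (1 : Matrix n n ℂ)).mulVecLin = ⊥

/-- The condition `(∗∗)`. -/
def StarStar (E : System n N) : Prop :=
  ∀ (i : Fin (N + 1)) (τ : ℂ),
    (⨆ j : Fin (N + 1), ⨆ _ : j ≠ i, LinearMap.range (E.res j).mulVecLin) ⊔
      LinearMap.range (E.res i + τ • (1 : Matrix n n ℂ)).mulVecLin = ⊤

/-- The matrix `F̂`, all of whose block rows are `(B_0 B_1 … B_N)`. -/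
def Fhat (E : System n N) : Matrix (Fin (N + 1) × n) (Fin (N + 1) × n) ℂ :=
  Matrix.of fun s t => E.res t.1 s.2 t.2

/-- The matrix `F_i`, `1 ≤ i ≤ N`, whose block row of index `i` (block rows are numbered from
`0` to `N`) is `(B_0 … B_i - (1 - c) … B_N)` and whose other block rows vanish; `c` stands for
`q ^ λ`. -/
def F (E : System n N) (c : ℂ) (i : Fin N) :
    Matrix (Fin (N + 1) × n) (Fin (N + 1) × n) ℂ :=
  Matrix.of fun s t =>
    if s.1 = i.succ then
      (if t.1 = i.succ then E.res t.1 - (1 - c) • (1 : Matrix n n ℂ) else E.res t.1) s.2 t.2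
    else 0

/-- The `q`-convolution `c_λ(E_{B,b}) = E_{F,b}`, with `F_∞ = 1 - F̂`. -/
def conv (q lam : ℂ) (E : System n N) : System (Fin (N + 1) × n) N where
  Binf := 1 - E.Fhat
  B := E.F (q ^ lam)
  b := E.b
  b_ne_zero := E.b_ne_zero
  b_injective := E.b_injective

end System

/-! ### Spectral types -/

/-- The conjugate (transposed Young diagram) of the partition with parts `t` (parts equal to zero
are ignored): its `j`-th part is the number of parts of `t` that are at least `j`, where
`1 ≤ j ≤ max t`. -/
def conjugate (t : Multiset ℕ) : List ℕ :=
  (List.range t.sup).map fun j => t.countP fun k => j + 1 ≤ k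

/-- The Jordan cell `J(α, t)` of size `t`. -/
def jordanCell (α : ℂ) (t : ℕ) : Matrix (Fin t) (Fin t) ℂ :=
  Matrix.of fun i j => if i = j then α else if (i : ℕ) + 1 = j then 1 else 0

/-- `S` is the spectral type of the constant matrix `M`: `M` is similar to a direct sum of `r`
Jordan cells `J(β_j, t_j)`, and `S` consists of one pair `(α, m)` for each eigenvalue `α` of `M`,
where `m = m_1 m_2 …` is the conjugate of the partition formed by the sizes of the cells with
eigenvalue `α`. -/
def IsMatrixSpectralType {n : Type} [Fintype n] [DecidableEq n] (M : Matrix n n ℂ)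
    (S : Multiset (ℂ × List ℕ)) : Prop :=
  ∃ (r : ℕ) (β : Fin r → ℂ) (t : Fin r → ℕ) (e : n ≃ Σ j : Fin r, Fin (t j)) (P : GL n ℂ),
    (∀ j, 1 ≤ t j) ∧
    M = (P : Matrix n n ℂ) *
        (Matrix.blockDiagonal' fun j => jordanCell (β j) (t j)).submatrix e e *
        ((P⁻¹ : GL n ℂ) : Matrix n n ℂ) ∧
    S = (Finset.univ.image β).val.map fun α =>
      (α, conjugate ((Finset.univ.filter fun j => β j = α).val.map t))

/-- `S` is the spectral type of the polynomial matrix `A(x)`: `A(x)` is equivalent over `ℂ[x]` to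
a diagonal matrix `diag(d_1, d_2, …)` with `d_{i+1} ∣ d_i`, and `S` consists of one pair `(a, n)`
for each zero `a` of `det A(x)`, where `n = n_1 n_2 …` is the conjugate of the partition formed by
the orders of the `d_k` at `a`. -/
def IsDivisorSpectralType {n : Type} [Fintype n] [DecidableEq n] (A : Matrix n n ℂ[X])
    (S : Multiset (ℂ × List ℕ)) : Prop :=
  ∃ (d : Fin (Fintype.card n) → ℂ[X]) (e : n ≃ Fin (Fintype.card n)) (U V : GL n ℂ[X]),
    (∀ i j, i ≤ j → d j ∣ d i) ∧
    (U : Matrix n n ℂ[X]) * A * (V : Matrix n n ℂ[X]) = Matrix.diagonal (fun i => d (e i)) ∧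
    S = A.det.roots.toFinset.val.map fun a =>
      (a, conjugate (Finset.univ.val.map fun k => (d k).rootMultiplicity a))

/-- A triple `(S_0; S_∞; S_div)`. Each component is a collection of partitions, each written
together with the point (eigenvalue, resp. zero of the determinant) it belongs to. -/
structure SpectralType where
  zero : Multiset (ℂ × List ℕ)
  inf : Multiset (ℂ × List ℕ)
  div : Multiset (ℂ × List ℕ)

/-- `S` is the spectral type `(S_0; S_∞; S_div)` of the equation `E`. -/
def System.HasSpectralType {n : Type} [Fintype n] [DecidableEq n] {N : ℕ} (E : System n N)
    (S : SpectralType) : Prop :=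
  IsMatrixSpectralType E.Azero S.zero ∧ IsMatrixSpectralType E.Ainf S.inf ∧
    IsDivisorSpectralType E.A S.div

/-- Adjoin a block of size `k` at the eigenvalue `c`: if `c` occurs in `S`, then `k` is put in
front of its partition; otherwise `c` is added, with the partition `k`. -/
def adjoin (c : ℂ) (k : ℕ) (S : Multiset (ℂ × List ℕ)) : Multiset (ℂ × List ℕ) :=
  if c ∈ S.map Prod.fst then S.map fun x => if x.1 = c then (x.1, k :: x.2) else x
  else (c, [k]) ::ₘ S

/-- The change of `S_div`: each point `b_j` that is not of the form `c a`, with `a` a point of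
`S`, is added with the partition `k`; each point `a` of `S` is moved to `c a`, and `k` is put in
front of its partition when `c a` is one of the `b_j`. -/
def adjoinDiv {N : ℕ} (b : Fin N → ℂ) (c : ℂ) (k : ℕ) (S : Multiset (ℂ × List ℕ)) :
    Multiset (ℂ × List ℕ) :=
  (Finset.univ.filter fun j => ∀ x ∈ S, b j ≠ c * x.1).val.map (fun j => (b j, [k])) +
    S.map fun x => (c * x.1, if ∃ j, b j = c * x.1 then k :: x.2 else x.2)

end QDiff

end

noncomputable section

namespace QDiff

/-! ### Partitions and their conjugates -/

/-! The parts of a conjugate partition are the successive differences of the truncated sums `∑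
min(j, t_i)`, and these sums are kernel dimensions. For a constant matrix and an eigenvalue `α` they
are `dim ker (M - α)^j` (`nullity`). For a polynomial matrix and a point `a` they are the dimension
of the kernel of `A` over `ℂ[X]/(X - a)^j` (`divNullity`). Prepending a part `k` means that the new
dimension at `j + 1` is `k` plus the old one at `j`. The theorem thus reduces to comparing kernel
dimensions (`eq_adjoin`, `eq_adjoinDiv`). Since having a spectral type is an existence statement,
Jordan and Smith forms must also be constructed for the convolution.

Write `c = q^λ`. At `0` and `∞` the old matrix is `e + v u` and the new one is `e + u v`, with `e =
c` or `e = b_∞`, `u` injective and `v` surjective by (∗∗). Away from `e` the nullities agree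
(`nullity_add_mul_of_ne`). At `e` they shift by one step and gain `Nm` (`nullity_add_mul_self`).
Invertibility passes to the convolution because `e ≠ 0`.

For the divisors, `G(x) = diag(T, c T_1, …, c T_N) · core(x/c)`, where `T_i` is `T` without its
`i`-th factor (`conv_A_map`). Over any `ℂ[X]`-algebra the kernel of `core` is isomorphic to that of
`A` (`finrank_ker_core`). If `c a` is not one of the `b_i`, the diagonal factors are units near `c
a` and nothing changes. If `c a = b_i`, the factor of row `i` is a unit and all others vanish to
order one. So modulo `(X - b_i)^(j+1)` row `i` must hold exactly and the other rows only modulo `(X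
- b_i)^j`. Reduction maps this kernel onto the kernel of `core` modulo `(X - b_i)^j`, and its fibre
is the kernel of a block row, surjective by (∗∗), hence of dimension `Nm` (`divNullity_conv_of_eq`).
-/

/-- The sum of the truncations of the parts of `t` at `j`. -/
def truncSum (t : Multiset ℕ) (j : ℕ) : ℕ := (t.map (min j)).sum

theorem truncSum_zero (t : Multiset ℕ) : truncSum t 0 = 0 := by
  simp [truncSum]

theorem truncSum_succ (t : Multiset ℕ) (j : ℕ) :
    truncSum t (j + 1) = truncSum t j + t.countP fun k => j + 1 ≤ k := by
  induction t using Multiset.induction_on with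
  | empty => simp [truncSum]
  | cons a s ih =>
    simp only [truncSum, Multiset.map_cons, Multiset.sum_cons, Multiset.countP_cons] at ih ⊢
    split_ifs with h
    · rw [min_eq_left h, min_eq_left (by omega : j ≤ a)]; omega
    · rw [min_eq_right (by omega : a ≤ j + 1), min_eq_right (by omega : a ≤ j)]; omega

theorem lt_sup_iff_countP (t : Multiset ℕ) (j : ℕ) :
    j < t.sup ↔ 0 < t.countP fun k => j + 1 ≤ k := by
  rw [Multiset.countP_pos, ← not_le, Multiset.sup_le]
  simp only [not_forall, not_le, exists_prop, Nat.lt_iff_add_one_le]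

theorem conjugate_eq_nil_iff (t : Multiset ℕ) : conjugate t = [] ↔ ∀ k ∈ t, k = 0 := by
  rw [conjugate, List.map_eq_nil_iff, List.range_eq_nil, ← Nat.le_zero, Multiset.sup_le]
  simp only [Nat.le_zero]

/-- By `truncSum_succ` the differences of truncated sums are the parts of the conjugate, and the
first vanishing difference marks its length. -/
theorem conjugate_congr {t t' : Multiset ℕ} (h : ∀ j, truncSum t' j = truncSum t j) :
    conjugate t' = conjugate t := by
  have hc : ∀ j, (t'.countP fun k => j + 1 ≤ k) = t.countP fun k => j + 1 ≤ k := fun j => by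
    have h1 := truncSum_succ t j
    have h2 := truncSum_succ t' j
    rw [h, h] at h2
    omega
  have hs : t'.sup = t.sup := by
    refine eq_of_forall_lt_iff fun j => ?_
    rw [lt_sup_iff_countP, lt_sup_iff_countP, hc]
  simp only [conjugate, hs, hc]

/-- The first difference of truncated sums is `k`, and the later ones are the old differences moved
by one place. The bound `1 ≤ k` makes the new first part count towards the length. -/
theorem conjugate_cons {t t' : Multiset ℕ} {k : ℕ} (hk : 1 ≤ k)
    (h : ∀ j, truncSum t' (j + 1) = k + truncSum t j) :
    conjugate t' = k :: conjugate t := by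
  have h0 : (t'.countP fun k => 0 + 1 ≤ k) = k := by
    have h1 := truncSum_succ t' 0
    rw [h, truncSum_zero, truncSum_zero] at h1
    omega
  have hc : ∀ j, (t'.countP fun k => j + 1 + 1 ≤ k) = t.countP fun k => j + 1 ≤ k := fun j => by
    have h1 := truncSum_succ t j
    have h2 := truncSum_succ t' (j + 1)
    rw [h, h] at h2
    omega
  have hs : t'.sup = t.sup + 1 := by
    refine eq_of_forall_lt_iff fun j => ?_
    cases j with
    | zero => rw [lt_sup_iff_countP, h0]; omega
    | succ j => rw [lt_sup_iff_countP, hc, Nat.succ_lt_succ_iff, lt_sup_iff_countP]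
  simp only [conjugate, hs, List.range_succ_eq_map, List.map_cons, List.map_map, h0]
  congr 1
  exact List.map_congr_left fun j _ => hc j

/-! ### Spectral data determined by nullities -/

/-- `S` collects, at each point `α`, the partition whose conjugate has truncated sums `ν α j`. -/
def IsSpectrum (ν : ℂ → ℕ → ℕ) (S : Multiset (ℂ × List ℕ)) : Prop :=
  ∃ (Z : Finset ℂ) (P : ℂ → List ℕ), S = Z.val.map (fun α => (α, P α)) ∧
    (∀ α, α ∈ Z ↔ P α ≠ []) ∧ ∀ α, ∃ t, P α = conjugate t ∧ ∀ j, truncSum t j = ν α j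

theorem map_fst_graph (Z : Finset ℂ) (P : ℂ → List ℕ) :
    (Z.val.map fun α => (α, P α)).map Prod.fst = Z.val := by
  simp

/-- A spectrum is the graph of a partition-valued function over its support, so it is enough to
compare the two functions pointwise and then the two supports. -/
theorem eq_adjoin {ν ν' : ℂ → ℕ → ℕ} {S S' : Multiset (ℂ × List ℕ)} {c : ℂ} {k : ℕ}
    (hk : 1 ≤ k) (hS : IsSpectrum ν S) (hS' : IsSpectrum ν' S')
    (hc : ∀ j, ν' c (j + 1) = k + ν c j) (hne : ∀ α, α ≠ c → ∀ j, ν' α j = ν α j) :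
    S' = adjoin c k S := by
  classical
  obtain ⟨Z, P, rfl, hZ, hP⟩ := hS
  obtain ⟨Z', P', rfl, hZ', hP'⟩ := hS'
  have h1 : P' c = k :: P c := by
    obtain ⟨t, e, h⟩ := hP c
    obtain ⟨t', e', h'⟩ := hP' c
    rw [e, e']
    exact conjugate_cons hk fun j => by rw [h, h', hc]
  have h2 : ∀ α, α ≠ c → P' α = P α := fun α hα => by
    obtain ⟨t, e, h⟩ := hP α
    obtain ⟨t', e', h'⟩ := hP' α
    rw [e, e']
    exact conjugate_congr fun j => by rw [h, h', hne α hα]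
  have hmem : ∀ α, α ∈ Z' ↔ α = c ∨ α ∈ Z := fun α => by
    by_cases hα : α = c
    · simp [hα, hZ', h1]
    · simp [hα, hZ', hZ, h2 α hα]
  unfold adjoin
  rw [map_fst_graph]
  split_ifs with h
  · have : Z' = Z := by
      ext α
      rw [hmem]
      exact or_iff_right_of_imp fun e => e ▸ h
    rw [this, Multiset.map_map]
    refine Multiset.map_congr rfl fun α _ => ?_
    by_cases hα : α = c
    · simp [hα, h1]
    · simp [hα, h2 α hα]
  · have hcZ : c ∉ Z := h
    have : Z' = Finset.cons c Z hcZ := by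
      ext α
      simp [hmem]
    rw [this, Finset.cons_val, Multiset.map_cons, h1,
      not_not.mp (mt (hZ c).mpr hcZ)]
    congr 1
    refine Multiset.map_congr rfl fun α hα => ?_
    rw [h2 α (fun e => hcZ (e ▸ hα))]

theorem eq_adjoinDiv {ν ν' : ℂ → ℕ → ℕ} {S S' : Multiset (ℂ × List ℕ)} {N : ℕ} {b : Fin N → ℂ}
    (hb : Function.Injective b) {c : ℂ} (hc0 : c ≠ 0) {k : ℕ}
    (hk : 1 ≤ k) (hS : IsSpectrum ν S) (hS' : IsSpectrum ν' S')
    (hmb : ∀ a, (∃ i, b i = c * a) → ∀ j, ν' (c * a) (j + 1) = k + ν a j)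
    (hnb : ∀ a, (¬ ∃ i, b i = c * a) → ∀ j, ν' (c * a) j = ν a j) :
    S' = adjoinDiv b c k S := by
  classical
  obtain ⟨Z, P, rfl, hZ, hP⟩ := hS
  obtain ⟨Z', P', rfl, hZ', hP'⟩ := hS'
  have key : ∀ a, P' (c * a) = if ∃ i, b i = c * a then k :: P a else P a := fun a => by
    obtain ⟨t, e, h⟩ := hP a
    obtain ⟨t', e', h'⟩ := hP' (c * a)
    rw [e, e']
    split_ifs with hi
    · exact conjugate_cons hk fun j => by rw [h, h', hmb a hi]
    · exact conjugate_congr fun j => by rw [h, h', hnb a hi]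
  have hinj : Function.Injective fun a : ℂ => c * a := fun x y h => mul_left_cancel₀ hc0 h
  unfold adjoinDiv
  have hfil : (Finset.univ.filter fun j => ∀ x ∈ Z.val.map (fun α => (α, P α)), b j ≠ c * x.1) =
      Finset.univ.filter fun j => ∀ a ∈ Z, b j ≠ c * a := by
    ext j
    simp
  rw [hfil]
  set J := Finset.univ.filter fun j => ∀ a ∈ Z, b j ≠ c * a with hJ
  have hdis : Disjoint (J.map ⟨b, hb⟩) (Z.map ⟨_, hinj⟩) := by
    rw [Finset.disjoint_left]
    intro x hx hx'
    simp only [Finset.mem_map, Function.Embedding.coeFn_mk] at hx hx'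
    obtain ⟨j, hj, rfl⟩ := hx
    obtain ⟨a, ha, hja⟩ := hx'
    exact (Finset.mem_filter.mp hj).2 a ha hja.symm
  have hZeq : Z' = (J.map ⟨b, hb⟩).disjUnion (Z.map ⟨_, hinj⟩) hdis := by
    ext x
    obtain ⟨a, rfl⟩ : ∃ a, x = c * a := ⟨c⁻¹ * x, by field_simp⟩
    simp only [Finset.mem_disjUnion, Finset.mem_map, Function.Embedding.coeFn_mk, hZ', key]
    have hm : (∃ a_1 ∈ Z, c * a_1 = c * a) ↔ a ∈ Z :=
      ⟨fun ⟨a', h, e⟩ => hinj e ▸ h, fun h => ⟨a, h, rfl⟩⟩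
    rw [hm]
    by_cases ha : a ∈ Z
    · have := (hZ a).mp ha
      split_ifs <;> simp [ha, this]
    · have hPa := not_not.mp (mt (hZ a).mpr ha)
      rw [hPa]
      split_ifs with hi
      · obtain ⟨i, hi⟩ := hi
        simp only [ne_eq, List.cons_ne_nil, not_false_eq_true, ha, or_false, true_iff]
        refine ⟨i, Finset.mem_filter.mpr ⟨Finset.mem_univ _, fun a' ha' e => ha ?_⟩, hi⟩
        rwa [← hinj (e.symm.trans hi)]
      · simp only [ne_eq, not_true_eq_false, ha, or_false, false_iff]
        rintro ⟨i, -, hi'⟩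
        exact hi ⟨i, hi'⟩
  rw [hZeq, Finset.disjUnion_val, Multiset.map_add, Finset.map_val, Finset.map_val,
    Multiset.map_map, Multiset.map_map, Multiset.map_map]
  congr 1
  · refine Multiset.map_congr rfl fun j hj => ?_
    have hj' := (Finset.mem_filter.mp (Finset.mem_val.mp hj)).2
    obtain ⟨a, ha⟩ : ∃ a, b j = c * a := ⟨c⁻¹ * b j, by field_simp⟩
    -- A point `b j` outside `c Z` comes from an `a` with empty partition, so prepending `k` leaves
    -- exactly `[k]`.
    have hPa : P a = [] := not_not.mp (mt (hZ a).mpr fun h => hj' a h ha)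
    simp only [Function.comp, Function.Embedding.coeFn_mk]
    rw [ha, key, if_pos ⟨j, ha⟩, hPa]
  · refine Multiset.map_congr rfl fun a _ => ?_
    simp only [Function.comp, Function.Embedding.coeFn_mk, key]

/-! ### Truncated polynomial rings -/

/-- `ℂ[X] / (X - a) ^ j`. -/
abbrev Trunc (a : ℂ) (j : ℕ) : Type := ℂ[X] ⧸ Ideal.span {(X - C a) ^ j}

instance (a : ℂ) (j : ℕ) : Module.Finite ℂ (Trunc a j) :=
  ((monic_X_sub_C a).pow j).finite_quotient

theorem finrank_trunc (a : ℂ) (j : ℕ) : Module.finrank ℂ (Trunc a j) = j := by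
  rw [finrank_quotient_span_eq_natDegree, natDegree_pow, natDegree_X_sub_C, mul_one]

theorem smul_trunc_mk (a : ℂ) (j : ℕ) (z : ℂ) (p : ℂ[X]) :
    (z • Ideal.Quotient.mk (Ideal.span {(X - C a) ^ j}) p : Trunc a j) =
      Ideal.Quotient.mk (Ideal.span {(X - C a) ^ j}) (C z * p) := by
  rw [← smul_eq_C_mul]
  rfl

/-- The powers of `X - a` are listed in descending order, so that multiplication by `X` sends each
vector to `a` times itself plus its predecessor, matching the superdiagonal of `jordanCell`. -/
theorem linearIndependent_trunc (a : ℂ) (j : ℕ) :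
    LinearIndependent ℂ fun k : Fin j =>
      (Ideal.Quotient.mk (Ideal.span {(X - C a) ^ j}) ((X - C a) ^ (j - 1 - k : ℕ)) : Trunc a j) := by
  rw [Fintype.linearIndependent_iff]
  intro g hg i
  have h1 : Ideal.Quotient.mk (Ideal.span {(X - C a) ^ j})
      (∑ k : Fin j, C (g k) * (X - C a) ^ (j - 1 - k : ℕ)) = 0 := by
    rw [← hg, map_sum]
    refine Finset.sum_congr rfl fun k _ => ?_
    rw [smul_trunc_mk]
  rw [Ideal.Quotient.eq_zero_iff_mem, Ideal.mem_span_singleton] at h1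
  -- Translation by `a` turns `X - a` into `X`, and divisibility by `X ^ j` can be read off
  -- coefficients.
  have h2 : (X : ℂ[X]) ^ j ∣ ∑ k : Fin j, C (g k) * X ^ (j - 1 - k : ℕ) := by
    have h3 := map_dvd (taylorAlgHom a) h1
    simpa [map_sum, map_mul, map_pow] using h3
  have h4 := X_pow_dvd_iff.mp h2 (j - 1 - i) (by omega)
  rw [finsetSum_coeff, Finset.sum_eq_single i] at h4
  · simpa using h4
  · intro k _ hk
    rw [coeff_C_mul, coeff_X_pow, if_neg, mul_zero]
    have : (k : ℕ) ≠ i := fun h => hk (Fin.ext h)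
    omega
  · simp

/-- The basis of `ℂ[X] / (X - a) ^ j` in which multiplication by `X` is a Jordan cell. -/
theorem exists_basis_trunc (a : ℂ) (j : ℕ) : ∃ b : Module.Basis (Fin j) ℂ (Trunc a j),
    ∀ k, (X : ℂ[X]) • b k = ∑ i, jordanCell a j i k • b i := by
  refine ⟨Module.Basis.mk (linearIndependent_trunc a j)
    ((linearIndependent_trunc a j).span_eq_top_of_card_eq_finrank' (by simp [finrank_trunc])).ge,
    fun k => ?_⟩
  simp only [Module.Basis.mk_apply]
  have hX : ∀ n : ℕ, (X : ℂ[X]) • (Ideal.Quotient.mk (Ideal.span {(X - C a) ^ j}) ((X - C a) ^ n) :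
      Trunc a j) = a • Ideal.Quotient.mk (Ideal.span {(X - C a) ^ j}) ((X - C a) ^ n) +
        Ideal.Quotient.mk (Ideal.span {(X - C a) ^ j}) ((X - C a) ^ (n + 1)) := fun n => by
    have : (X : ℂ[X]) * (X - C a) ^ n = C a * (X - C a) ^ n + (X - C a) ^ (n + 1) := by ring
    rw [smul_trunc_mk, ← map_add, ← this]
    rfl
  rw [hX]
  by_cases hk : (k : ℕ) = 0
  · rw [Finset.sum_eq_single k]
    · have : (Ideal.Quotient.mk (Ideal.span {(X - C a) ^ j}) ((X - C a) ^ (j - 1 - k + 1 : ℕ)) :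
          Trunc a j) = 0 := by
        rw [Ideal.Quotient.eq_zero_iff_mem, Ideal.mem_span_singleton]
        exact pow_dvd_pow _ (by omega)
      rw [this, add_zero]
      simp [jordanCell]
    · intro i _ hik
      rw [jordanCell, Matrix.of_apply, if_neg hik, if_neg (by omega), zero_smul]
    · simp
  · have hlt : (k : ℕ) - 1 < j := by omega
    have hne : k ≠ ⟨k - 1, hlt⟩ := fun h => by
      have := congrArg Fin.val h
      simp at this
      omega
    rw [Finset.sum_eq_add k ⟨k - 1, hlt⟩ hne]
    · congr 1
      · simp [jordanCell]
      · rw [jordanCell, Matrix.of_apply, if_neg hne.symm, if_pos (by simp; omega), one_smul]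
        congr 2
        simp
        omega
    · intro i _ hi
      rw [jordanCell, Matrix.of_apply, if_neg hi.1, if_neg, zero_smul]
      intro h
      exact hi.2 (Fin.ext (by simp; omega))
    · simp
    · simp

/-! ### The Jordan normal form -/

/-- Through `f`, the space `V` is a torsion `ℂ[X]`-module, hence a direct sum of quotients by powers
of irreducibles, which are linear over `ℂ`; each summand is one Jordan cell. Cells of size zero may
occur. -/
theorem exists_jordan_basis {V : Type} [AddCommGroup V] [Module ℂ V] [FiniteDimensional ℂ V]
    (f : V →ₗ[ℂ] V) : ∃ (ι : Type) (_ : Fintype ι) (_ : DecidableEq ι) (β : ι → ℂ) (t : ι → ℕ)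
      (b : Module.Basis (Σ i, Fin (t i)) ℂ V),
      ∀ i k, f (b ⟨i, k⟩) = ∑ l, jordanCell (β i) (t i) l k • b ⟨i, l⟩ := by
  classical
  obtain ⟨ι, hι, p, hp, t, ⟨φ⟩⟩ := Module.equiv_directSum_of_isTorsion
    (Module.AEval.isTorsion_of_finiteDimensional ℂ V f)
  have hq : ∀ i, ∃ β : ℂ, ∃ b : Module.Basis (Fin (t i)) ℂ (ℂ[X] ⧸ Submodule.span ℂ[X] {p i ^ t i}),
      ∀ k, (X : ℂ[X]) • b k = ∑ l, jordanCell β (t i) l k • b l := fun i => by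
    obtain ⟨β, hβ⟩ := IsAlgClosed.exists_root (p i)
      (by rw [IsAlgClosed.degree_eq_one_of_irreducible ℂ (hp i)]; exact one_ne_zero)
    have h1 : Associated (X - C β) (p i) :=
      (irreducible_X_sub_C β).associated_of_dvd (hp i) (dvd_iff_isRoot.mpr hβ)
    have h2 : Submodule.span ℂ[X] {p i ^ t i} = Ideal.span {(X - C β) ^ t i} :=
      Ideal.span_singleton_eq_span_singleton.mpr (h1.pow_pow).symm
    rw [h2]
    exact ⟨β, exists_basis_trunc β (t i)⟩
  choose β b hb using hq
  let ψ : V ≃ₗ[ℂ] (∀ i, ℂ[X] ⧸ Submodule.span ℂ[X] {p i ^ t i}) :=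
    (Module.AEval'.of f).trans ((φ.restrictScalars ℂ).trans
      (DirectSum.linearEquivFunOnFintype ℂ ι _))
  have hψ : ∀ x, ψ (f x) = (X : ℂ[X]) • ψ x := fun x => by
    have h1 : Module.AEval'.of f (f x) = (X : ℂ[X]) • Module.AEval'.of f x :=
      (Module.AEval'.X_smul_of f x).symm
    have h2 : φ (Module.AEval'.of f (f x)) = (X : ℂ[X]) • φ (Module.AEval'.of f x) := by
      rw [h1, map_smul]
    ext i
    exact DFunLike.congr_fun h2 i
  refine ⟨ι, hι, inferInstance, β, t, (Pi.basis b).map ψ.symm, fun i k => ?_⟩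
  apply ψ.injective
  rw [hψ, map_sum]
  simp only [Module.Basis.map_apply, LinearEquiv.apply_symm_apply, map_smul, Pi.basis_apply]
  ext l
  by_cases h : l = i
  · subst h
    simp only [Pi.smul_apply, Finset.sum_apply, Pi.single_eq_same]
    exact hb l k
  · simp only [Pi.smul_apply, Finset.sum_apply, Pi.single_eq_of_ne h, smul_zero,
      Finset.sum_const_zero]

/-! ### Dimensions of kernels -/

theorem finrank_ker_eq_of_conj {V V' W W' : Type*} [AddCommGroup V] [Module ℂ V] [AddCommGroup V']
    [Module ℂ V'] [AddCommGroup W] [Module ℂ W] [AddCommGroup W'] [Module ℂ W']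
    {f : V →ₗ[ℂ] V'} {g : W →ₗ[ℂ] W'} (e : V ≃ₗ[ℂ] W) (e' : V' ≃ₗ[ℂ] W')
    (h : ∀ x, e' (f x) = g (e x)) :
    Module.finrank ℂ (LinearMap.ker f) = Module.finrank ℂ (LinearMap.ker g) := by
  refine LinearEquiv.finrank_eq (LinearEquiv.ofSubmodules e _ _ ?_)
  ext y
  rw [Submodule.mem_map_equiv, LinearMap.mem_ker, LinearMap.mem_ker,
    ← e'.map_eq_zero_iff, h, e.apply_symm_apply]

theorem finrank_ker_piMap {ι : Type*} [Fintype ι] {V W : ι → Type*} [∀ i, AddCommGroup (V i)]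
    [∀ i, Module ℂ (V i)] [∀ i, FiniteDimensional ℂ (V i)] [∀ i, AddCommGroup (W i)]
    [∀ i, Module ℂ (W i)] (f : ∀ i, V i →ₗ[ℂ] W i) :
    Module.finrank ℂ (LinearMap.ker (LinearMap.piMap f)) =
      ∑ i, Module.finrank ℂ (LinearMap.ker (f i)) := by
  rw [← Module.finrank_pi_fintype]
  refine LinearEquiv.finrank_eq
    { toFun := fun x i => ⟨x.1 i, congrFun (LinearMap.mem_ker.mp x.2) i⟩
      invFun := fun y => ⟨fun i => (y i).1, LinearMap.mem_ker.mpr (funext fun i => (y i).2)⟩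
      map_add' := fun _ _ => rfl
      map_smul' := fun _ _ => rfl
      left_inv := fun _ => rfl
      right_inv := fun _ => rfl }

theorem finrank_ker_mulVecLin {n : Type*} [Fintype n] (A : Matrix n n ℂ) :
    Module.finrank ℂ (LinearMap.ker A.mulVecLin) = Fintype.card n - A.rank := by
  have h := LinearMap.finrank_range_add_finrank_ker A.mulVecLin
  rw [Module.finrank_fintype_fun_eq_card] at h
  rw [Matrix.rank]
  omega

theorem finrank_ker_blockDiagonal' {ι : Type*} [Fintype ι] [DecidableEq ι] {κ : ι → Type*}
    [∀ i, Fintype (κ i)] (A : ∀ i, Matrix (κ i) (κ i) ℂ) :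
    Module.finrank ℂ (LinearMap.ker (Matrix.blockDiagonal' A).mulVecLin) =
      ∑ i, Module.finrank ℂ (LinearMap.ker (A i).mulVecLin) := by
  rw [← finrank_ker_piMap]
  refine finrank_ker_eq_of_conj (LinearEquiv.piCurry ℂ fun _ _ => ℂ)
    (LinearEquiv.piCurry ℂ fun _ _ => ℂ) fun x => ?_
  ext i k
  change ∑ s : Σ i, κ i, Matrix.blockDiagonal' A ⟨i, k⟩ s * x s = ∑ l, A i k l * x ⟨i, l⟩
  rw [Fintype.sum_sigma, Finset.sum_eq_single i]
  · simp
  · intro j _ hj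
    simp [Matrix.blockDiagonal'_apply_ne _ _ _ hj.symm]
  · simp

/-- Multiplication by `d ≠ 0` on `ℂ[X] / (X - a) ^ j`. -/
theorem finrank_ker_mulLeft_trunc (a : ℂ) (j : ℕ) {d : ℂ[X]} (hd : d ≠ 0) :
    Module.finrank ℂ (LinearMap.ker
      (LinearMap.mulLeft ℂ (Ideal.Quotient.mk (Ideal.span {(X - C a) ^ j}) d : Trunc a j))) =
      min j (d.rootMultiplicity a) := by
  set k := d.rootMultiplicity a with hk
  have hle : Ideal.span {(X - C a) ^ j} ≤ Ideal.span {(X - C a) ^ (j - k)} := by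
    rw [Ideal.span_singleton_le_span_singleton]
    exact pow_dvd_pow _ (Nat.sub_le _ _)
  -- Multiplication by `d` kills exactly the multiples of `(X - a)^(j - k)`, the kernel of this
  -- reduction. Truncated subtraction covers `j ≤ k`, where the target is the zero ring.
  let φ : Trunc a j →ₗ[ℂ] Trunc a (j - k) := (Ideal.Quotient.factorₐ ℂ hle).toLinearMap
  have hφ : ∀ p, φ (Ideal.Quotient.mk _ p) = Ideal.Quotient.mk _ p := fun p => rfl
  have hsurj : Function.Surjective φ := fun y => by
    obtain ⟨p, rfl⟩ := Ideal.Quotient.mk_surjective y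
    exact ⟨Ideal.Quotient.mk _ p, rfl⟩
  have hker : LinearMap.ker
      (LinearMap.mulLeft ℂ (Ideal.Quotient.mk (Ideal.span {(X - C a) ^ j}) d : Trunc a j)) =
      LinearMap.ker φ := by
    ext y
    obtain ⟨p, rfl⟩ := Ideal.Quotient.mk_surjective y
    rw [LinearMap.mem_ker, LinearMap.mem_ker, hφ, LinearMap.mulLeft_apply, ← map_mul,
      Ideal.Quotient.eq_zero_iff_mem, Ideal.Quotient.eq_zero_iff_mem, Ideal.mem_span_singleton,
      Ideal.mem_span_singleton]
    obtain ⟨u, hu, hau⟩ := exists_eq_pow_rootMultiplicity_mul_and_not_dvd d hd a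
    rw [← hk] at hu
    rcases le_total j k with hjk | hjk
    · rw [Nat.sub_eq_zero_of_le hjk, pow_zero]
      refine iff_of_true ?_ (one_dvd _)
      exact Dvd.dvd.mul_right ((pow_dvd_pow _ hjk).trans (hu ▸ dvd_mul_right _ _)) _
    · rw [hu, mul_assoc]
      conv_lhs => rw [← Nat.add_sub_cancel' hjk, pow_add]
      rw [mul_dvd_mul_iff_left (pow_ne_zero _ (X_sub_C_ne_zero a))]
      exact ⟨fun h => (prime_X_sub_C a).pow_dvd_of_dvd_mul_left _ hau h, fun h => h.mul_left _⟩
  have h := LinearMap.finrank_range_add_finrank_ker φ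
  rw [LinearMap.range_eq_top.mpr hsurj, finrank_top, finrank_trunc, finrank_trunc] at h
  rw [hker]
  refine Eq.trans ?_ (by omega : j - (j - k) = min j k)
  exact (Nat.sub_eq_of_eq_add' h.symm).symm

/-! ### Spectral types of constant matrices -/

/-- `dim ker (M - α) ^ j`. -/
def nullity {n : Type*} [Fintype n] [DecidableEq n] (M : Matrix n n ℂ) (α : ℂ) (j : ℕ) : ℕ :=
  Module.finrank ℂ (LinearMap.ker ((M - α • (1 : Matrix n n ℂ)) ^ j).mulVecLin)

/-- The cell is multiplication by `X` on `ℂ[X]/(X - β)^t`, so `(J - α)^j` is multiplication by `(X -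
α)^j`, whose order at `β` is `j` or `0`. -/
theorem nullity_jordanCell (β : ℂ) (t : ℕ) (α : ℂ) (j : ℕ) :
    nullity (jordanCell β t) α j = if β = α then min j t else 0 := by
  obtain ⟨b, hb⟩ := exists_basis_trunc β t
  have hX : Algebra.leftMulMatrix b (Ideal.Quotient.mk (Ideal.span {(X - C β) ^ t}) X) =
      jordanCell β t := by
    ext i k
    rw [Algebra.leftMulMatrix_eq_repr_mul]
    have h : (Ideal.Quotient.mk (Ideal.span {(X - C β) ^ t}) X : Trunc β t) * b k =
        ∑ i, jordanCell β t i k • b i := by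
      rw [← hb]
      obtain ⟨p, hp⟩ := Ideal.Quotient.mk_surjective (b k)
      rw [← hp]
      rfl
    rw [h]
    simp [Finsupp.single_apply]
  have hα : Algebra.leftMulMatrix b (Ideal.Quotient.mk (Ideal.span {(X - C β) ^ t}) (C α)) =
      α • (1 : Matrix (Fin t) (Fin t) ℂ) := by
    rw [← Algebra.algebraMap_eq_smul_one]
    exact (Algebra.leftMulMatrix b).commutes α
  have hpow : (jordanCell β t - α • (1 : Matrix (Fin t) (Fin t) ℂ)) ^ j =
      Algebra.leftMulMatrix b (Ideal.Quotient.mk (Ideal.span {(X - C β) ^ t}) ((X - C α) ^ j)) := by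
    rw [← hX, ← hα, ← map_sub, ← map_pow, map_pow _ (X - C α), map_sub]
  have h := finrank_ker_mulLeft_trunc β t (pow_ne_zero j (X_sub_C_ne_zero α))
  rw [nullity, hpow]
  rw [finrank_ker_eq_of_conj (g := (Algebra.leftMulMatrix b
    (Ideal.Quotient.mk (Ideal.span {(X - C β) ^ t}) ((X - C α) ^ j))).mulVecLin)
    b.equivFun b.equivFun fun x => (Algebra.leftMulMatrix_mulVec_repr b _ x).symm] at h
  rw [h]
  split_ifs with hβ
  · rw [hβ, rootMultiplicity_X_sub_C_pow, min_comm]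
  · rw [rootMultiplicity_eq_zero, Nat.min_zero]
    simpa [sub_eq_zero] using fun h => (hβ h).elim

theorem nullity_conj {n : Type*} [Fintype n] [DecidableEq n] (P : GL n ℂ) (J : Matrix n n ℂ)
    (α : ℂ) (j : ℕ) :
    nullity ((P : Matrix n n ℂ) * J * ((P⁻¹ : GL n ℂ) : Matrix n n ℂ)) α j = nullity J α j := by
  have h1 : (P : Matrix n n ℂ) * ((P⁻¹ : GL n ℂ) : Matrix n n ℂ) = 1 := P.mul_inv
  have h : (P : Matrix n n ℂ) * J * ((P⁻¹ : GL n ℂ) : Matrix n n ℂ) - α • (1 : Matrix n n ℂ) =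
      (P : Matrix n n ℂ) * (J - α • (1 : Matrix n n ℂ)) * ((P⁻¹ : GL n ℂ) : Matrix n n ℂ) := by
    rw [mul_sub, sub_mul, mul_smul_comm, smul_mul_assoc, mul_one, h1]
  have hd : IsUnit ((P⁻¹ : GL n ℂ) : Matrix n n ℂ).det :=
    (Matrix.isUnit_iff_isUnit_det _).mp (P⁻¹).isUnit
  have hd' : IsUnit (P : Matrix n n ℂ).det := (Matrix.isUnit_iff_isUnit_det _).mp P.isUnit
  rw [nullity, nullity, finrank_ker_mulVecLin, finrank_ker_mulVecLin, h, Units.conj_pow,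
    Matrix.rank_mul_eq_left_of_isUnit_det _ _ hd, Matrix.rank_mul_eq_right_of_isUnit_det _ _ hd']

theorem nullity_submatrix {n κ : Type*} [Fintype n] [DecidableEq n] [Fintype κ] [DecidableEq κ]
    (e : n ≃ κ) (J : Matrix κ κ ℂ) (α : ℂ) (j : ℕ) :
    nullity (J.submatrix e e) α j = nullity J α j := by
  have h : (J.submatrix e e - α • (1 : Matrix n n ℂ)) ^ j =
      ((J - α • (1 : Matrix κ κ ℂ)) ^ j).submatrix e e := by
    have h1 : J.submatrix e e - α • (1 : Matrix n n ℂ) =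
        Matrix.reindexAlgEquiv ℂ ℂ e.symm (J - α • (1 : Matrix κ κ ℂ)) := by
      rw [map_sub, map_smul, map_one]
      rfl
    rw [h1, ← map_pow]
    rfl
  rw [nullity, nullity, finrank_ker_mulVecLin, finrank_ker_mulVecLin, h, Matrix.rank_submatrix,
    Fintype.card_congr e]

theorem nullity_blockDiagonal' {ι : Type*} [Fintype ι] [DecidableEq ι] {κ : ι → Type*}
    [∀ i, Fintype (κ i)] [∀ i, DecidableEq (κ i)] (A : ∀ i, Matrix (κ i) (κ i) ℂ) (α : ℂ) (j : ℕ) :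
    nullity (Matrix.blockDiagonal' A) α j = ∑ i, nullity (A i) α j := by
  have h : (Matrix.blockDiagonal' A - α • 1) ^ j =
      Matrix.blockDiagonal' fun i => (A i - α • (1 : Matrix (κ i) (κ i) ℂ)) ^ j := by
    have h1 : Matrix.blockDiagonal' A - α • 1 =
        Matrix.blockDiagonal' fun i => A i - α • (1 : Matrix (κ i) (κ i) ℂ) := by
      rw [← Matrix.blockDiagonal'_one, ← Matrix.blockDiagonal'_smul, ← Matrix.blockDiagonal'_sub]
      rfl
    rw [h1, ← Matrix.blockDiagonal'_pow]
    rfl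
  rw [nullity, h, finrank_ker_blockDiagonal']
  rfl

theorem IsMatrixSpectralType.isSpectrum {n : Type} [Fintype n] [DecidableEq n] {M : Matrix n n ℂ}
    {S : Multiset (ℂ × List ℕ)} (h : IsMatrixSpectralType M S) : IsSpectrum (nullity M) S := by
  obtain ⟨r, β, t, e, P, ht, rfl, rfl⟩ := h
  refine ⟨Finset.univ.image β,
    fun α => conjugate ((Finset.univ.filter fun j => β j = α).val.map t), rfl, fun α => ?_,
    fun α => ⟨_, rfl, fun j => ?_⟩⟩
  · rw [Ne, conjugate_eq_nil_iff]
    simp only [Finset.mem_image, Finset.mem_univ, true_and, Multiset.mem_map, Finset.mem_val,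
      Finset.mem_filter, not_forall]
    refine ⟨fun ⟨i, hi⟩ => ⟨t i, ⟨i, hi, rfl⟩, by have := ht i; omega⟩, ?_⟩
    rintro ⟨_, ⟨i, hi, -⟩, -⟩
    exact ⟨i, hi⟩
  · rw [nullity_conj, nullity_submatrix, nullity_blockDiagonal', truncSum, Multiset.map_map]
    simp only [nullity_jordanCell]
    rw [← Finset.sum_filter]
    rfl

theorem exists_isMatrixSpectralType {n : Type} [Fintype n] [DecidableEq n] (M : Matrix n n ℂ) :
    ∃ S, IsMatrixSpectralType M S := by
  obtain ⟨ι, hι, hd, β, t, b, hb⟩ := exists_jordan_basis M.mulVecLin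
  -- Empty cells are discarded, since a spectral type only admits cells of size at least one.
  let σ : Fin (Fintype.card {i // t i ≠ 0}) ≃ {i // t i ≠ 0} := (Fintype.equivFin _).symm
  let s : (Σ j, Fin (t (σ j))) → Σ i, Fin (t i) := fun x => ⟨σ x.1, x.2⟩
  have hs : Function.Bijective s := by
    constructor
    · rintro ⟨j, k⟩ ⟨j', k'⟩ h
      have h1 : (σ j : ι) = σ j' := congrArg Sigma.fst h
      obtain rfl := σ.injective (Subtype.ext h1)
      simpa [s] using h
    · rintro ⟨i, k⟩
      have hi : t i ≠ 0 := fun h => by have := k.2; omega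
      obtain ⟨j, hj⟩ := σ.surjective ⟨i, hi⟩
      have hj' : (σ j : ι) = i := congrArg Subtype.val hj
      subst hj'
      exact ⟨⟨j, k⟩, rfl⟩
  let b₁ := b.reindex (Equiv.ofBijective s hs).symm
  have hb₁ : ∀ x, b₁ x = b (s x) := fun x => by simp [b₁]
  let e : n ≃ Σ j, Fin (t (σ j)) := (Pi.basisFun ℂ n).indexEquiv b₁
  let b₂ := b₁.reindex e.symm
  have hb₂ : ∀ x, b₂ x = b₁ (e x) := fun x => by simp [b₂]
  let P : GL n ℂ := ⟨(Pi.basisFun ℂ n).toMatrix b₂, b₂.toMatrix (Pi.basisFun ℂ n),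
    Module.Basis.toMatrix_mul_toMatrix_flip _ _, Module.Basis.toMatrix_mul_toMatrix_flip _ _⟩
  refine ⟨_, _, fun j => β (σ j), fun j => t (σ j), e, P,
    fun j => Nat.one_le_iff_ne_zero.mpr (σ j).2, ?_, rfl⟩
  have hJ : LinearMap.toMatrix b₂ b₂ M.mulVecLin =
      (Matrix.blockDiagonal' fun j => jordanCell (β (σ j)) (t (σ j))).submatrix e e := by
    rw [← LinearEquiv.eq_symm_apply]
    refine b₂.ext fun x => ?_
    rw [LinearMap.toMatrix_symm, Matrix.toLin_self, ← Equiv.sum_comp e.symm]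
    obtain ⟨y, rfl⟩ := e.symm.surjective x
    obtain ⟨j, k⟩ := y
    simp only [hb₂, hb₁, Matrix.submatrix_apply, Equiv.apply_symm_apply]
    rw [Fintype.sum_sigma, Finset.sum_eq_single j]
    · simp only [Matrix.blockDiagonal'_apply_eq]
      exact hb _ _
    · intro j' _ hj'
      simp [Matrix.blockDiagonal'_apply_ne _ _ _ hj']
    · simp
  rw [← hJ]
  have h := basis_toMatrix_mul_linearMap_toMatrix_mul_basis_toMatrix (Pi.basisFun ℂ n) b₂
    (Pi.basisFun ℂ n) b₂ M.mulVecLin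
  change M = (Pi.basisFun ℂ n).toMatrix b₂ * _ * b₂.toMatrix (Pi.basisFun ℂ n)
  rw [h, LinearMap.toMatrix_eq_toMatrix']
  exact (LinearMap.toMatrix'_toLin' M).symm

/-! ### The Smith normal form over a Euclidean domain -/

/-- `B = U A V` with `U` and `V` invertible. -/
def MatEquiv {n R : Type*} [Fintype n] [DecidableEq n] [CommRing R] (A B : Matrix n n R) : Prop :=
  ∃ U V : Matrix n n R, IsUnit U.det ∧ IsUnit V.det ∧ U * A * V = B

namespace MatEquiv

variable {n R : Type*} [Fintype n] [DecidableEq n] [CommRing R] {A B D : Matrix n n R}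

theorem refl (A : Matrix n n R) : MatEquiv A A := ⟨1, 1, by simp, by simp, by simp⟩

theorem trans (h : MatEquiv A B) (h' : MatEquiv B D) : MatEquiv A D := by
  obtain ⟨U, V, hU, hV, rfl⟩ := h
  obtain ⟨U', V', hU', hV', rfl⟩ := h'
  exact ⟨U' * U, V * V', by simpa using ⟨hU', hU⟩, by simpa using ⟨hV, hV'⟩,
    by simp only [Matrix.mul_assoc]⟩

theorem mul_left (A : Matrix n n R) {U : Matrix n n R} (hU : IsUnit U.det) :
    MatEquiv A (U * A) :=
  ⟨U, 1, hU, by simp, by simp⟩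

theorem mul_right (A : Matrix n n R) {V : Matrix n n R} (hV : IsUnit V.det) :
    MatEquiv A (A * V) :=
  ⟨1, V, by simp, hV, by simp⟩

theorem of_submatrix {κ : Type*} [Fintype κ] [DecidableEq κ] (e : n ≃ κ)
    {B D : Matrix κ κ R} (h : MatEquiv B D) : MatEquiv (B.submatrix e e) (D.submatrix e e) := by
  obtain ⟨U, V, hU, hV, rfl⟩ := h
  exact ⟨U.submatrix e e, V.submatrix e e, by rwa [Matrix.det_submatrix_equiv_self],
    by rwa [Matrix.det_submatrix_equiv_self], by simp only [Matrix.submatrix_mul_equiv]⟩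

end MatEquiv

variable {R : Type*} [EuclideanDomain R]

theorem isUnit_det_swap {n : Type*} [Fintype n] [DecidableEq n] (i j : n) :
    IsUnit (Matrix.swap R i j).det := by
  rw [← Matrix.isUnit_iff_isUnit_det]
  exact (Matrix.GeneralLinearGroup.swap R i j).isUnit

/-- An entry that is minimal among the nonzero entries of all equivalent matrices divides its row
and its column. -/
theorem dvd_of_minimal {n : Type*} [Fintype n] [DecidableEq n] {M : Matrix n n R} {i₀ : n}
    (h0 : M i₀ i₀ ≠ 0)
    (hmin : ∀ M', MatEquiv M M' → ∀ i j, M' i j ≠ 0 → ¬ EuclideanDomain.r (M' i j) (M i₀ i₀))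
    (i : n) : M i₀ i₀ ∣ M i i₀ ∧ M i₀ i₀ ∣ M i₀ i := by
  by_cases hi : i = i₀
  · simp [hi]
  have hr : ∀ x : R, x + -(x / M i₀ i₀) * M i₀ i₀ = x % M i₀ i₀ := fun x => by
    have := EuclideanDomain.div_add_mod x (M i₀ i₀)
    linear_combination -this
  constructor
  · rw [← EuclideanDomain.mod_eq_zero]
    by_contra hne
    refine hmin (Matrix.transvection i i₀ (-(M i i₀ / M i₀ i₀)) * M)
      (MatEquiv.mul_left _ (by rw [Matrix.det_transvection_of_ne _ _ hi]; exact isUnit_one)) i i₀ ?_ ?_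
    · rwa [Matrix.transvection_mul_apply_same, hr]
    · rw [Matrix.transvection_mul_apply_same, hr]
      exact EuclideanDomain.mod_lt _ h0
  · rw [← EuclideanDomain.mod_eq_zero]
    by_contra hne
    refine hmin (M * Matrix.transvection i₀ i (-(M i₀ i / M i₀ i₀)))
      (MatEquiv.mul_right _ (by
        rw [Matrix.det_transvection_of_ne _ _ (Ne.symm hi)]; exact isUnit_one)) i₀ i ?_ ?_
    · rwa [Matrix.mul_transvection_apply_same, hr]
    · rw [Matrix.mul_transvection_apply_same, hr]
      exact EuclideanDomain.mod_lt _ h0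

/-- Among all nonzero entries of all equivalent matrices, take one that is minimal for the Euclidean
relation and swap it into the corner. Minimality makes it divide its row and column, which can then
be cleared. -/
theorem exists_matEquiv_fromBlocks {κ : Type*} [Fintype κ] [DecidableEq κ]
    (A : Matrix (Unit ⊕ κ) (Unit ⊕ κ) R) :
    ∃ (d : R) (D : Matrix κ κ R), (∀ i j, d ∣ D i j) ∧
      MatEquiv A (Matrix.fromBlocks (Matrix.of fun _ _ => d) 0 0 D) := by
  by_cases hA : A = 0
  · refine ⟨0, 0, by simp, ?_⟩
    have : Matrix.fromBlocks (Matrix.of fun _ _ : Unit => (0 : R)) 0 0 (0 : Matrix κ κ R) = A := by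
      rw [hA]
      ext (i | i) (j | j) <;> rfl
    rw [this]
    exact MatEquiv.refl A
  obtain ⟨i, j, hij⟩ : ∃ i j, A i j ≠ 0 := by
    by_contra! h
    exact hA (by ext i j; exact h i j)
  obtain ⟨d, ⟨hd0, M, hAM, i₁, j₁, hd⟩, hmin⟩ :=
    (EuclideanDomain.r_wellFounded (R := R)).has_min
      {d | d ≠ 0 ∧ ∃ M, MatEquiv A M ∧ ∃ i j, M i j = d} ⟨A i j, hij, A, MatEquiv.refl A, i, j, rfl⟩
  have hmin' : ∀ M', MatEquiv A M' → ∀ i j, M' i j ≠ 0 → ¬ EuclideanDomain.r (M' i j) d :=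
    fun M' h i j h0 => hmin _ ⟨h0, M', h, i, j, rfl⟩
  let i₀ : Unit ⊕ κ := Sum.inl ()
  have hdvd : ∀ M, MatEquiv A M → M i₀ i₀ = d → ∀ i, d ∣ M i i₀ ∧ d ∣ M i₀ i :=
    fun M hM hMd i => by
      have := dvd_of_minimal (M := M) (i₀ := i₀) (by rwa [hMd])
        (fun M' h' => by rw [hMd]; exact hmin' M' (hM.trans h')) i
      rwa [hMd] at this
  obtain ⟨M₁, hM₁, hM₁d⟩ : ∃ M₁, MatEquiv A M₁ ∧ M₁ i₀ i₀ = d := by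
    refine ⟨_, (hAM.trans (MatEquiv.mul_left _ (isUnit_det_swap i₀ i₁))).trans
      (MatEquiv.mul_right _ (isUnit_det_swap i₀ j₁)), ?_⟩
    rw [Matrix.mul_swap_apply_left, Matrix.swap_mul_apply_left, hd]
  have h₁ := hdvd M₁ hM₁ hM₁d
  choose c hc using fun i : κ => (h₁ (Sum.inr i)).1
  choose r hr using fun i : κ => (h₁ (Sum.inr i)).2
  let D : Matrix κ κ R := Matrix.of fun i j => M₁ (Sum.inr i) (Sum.inr j) - c i * d * r j
  have hblock : MatEquiv A (Matrix.fromBlocks (Matrix.of fun _ _ => d) 0 0 D) := by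
    have hM₁b : M₁ = Matrix.fromBlocks (Matrix.of fun _ _ => d) (Matrix.of fun _ j => d * r j)
        (Matrix.of fun i _ => c i * d) (Matrix.of fun i j => M₁ (Sum.inr i) (Sum.inr j)) := by
      ext (i | i) (j | j)
      · exact hM₁d
      · exact hr j
      · exact (hc i).trans (mul_comm _ _)
      · rfl
    refine hM₁.trans ⟨Matrix.fromBlocks 1 0 (Matrix.of fun i _ => -c i) 1,
      Matrix.fromBlocks 1 (Matrix.of fun _ j => -r j) 0 1, by simp, by simp, ?_⟩
    conv_lhs => rw [hM₁b]
    rw [Matrix.fromBlocks_multiply, Matrix.fromBlocks_multiply]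
    congr 1 <;> ext i j <;> simp [Matrix.mul_apply, D]; ring
  refine ⟨d, D, fun i j => ?_, hblock⟩
  -- Adding row `i` of `D` to the top row keeps `d` in the corner, so the divisibility of the top
  -- row now applies to the entries of `D`.
  have h₂ := hblock.trans (MatEquiv.mul_left _
    (U := Matrix.transvection i₀ (Sum.inr i) (1 : R))
    (by rw [Matrix.det_transvection_of_ne _ _ (by simp [i₀])]; exact isUnit_one))
  have h₃ := (hdvd _ h₂ (by
    rw [Matrix.transvection_mul_apply_same]
    simp [i₀]) (Sum.inr j)).2
  rw [Matrix.transvection_mul_apply_same] at h₃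
  simpa [i₀] using h₃

theorem exists_smith_fin (k : ℕ) (A : Matrix (Fin k) (Fin k) R) :
    ∃ d : Fin k → R, (∀ i j, i ≤ j → d i ∣ d j) ∧ MatEquiv A (Matrix.diagonal d) := by
  induction k with
  | zero => exact ⟨fun _ => 0, by simp, by convert MatEquiv.refl A using 1; ext i; exact i.elim0⟩
  | succ k ih =>
    let e : Fin (k + 1) ≃ Unit ⊕ Fin k :=
      (finSuccEquiv k).trans ((Equiv.optionEquivSumPUnit (Fin k)).trans (Equiv.sumComm _ _))
    have he0 : e 0 = Sum.inl () := by simp [e]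
    have hes : ∀ i : Fin k, e i.succ = Sum.inr i := fun i => by simp [e]
    obtain ⟨d, D, hdD, h⟩ := exists_matEquiv_fromBlocks (A.submatrix e.symm e.symm)
    obtain ⟨d', hd', U, V, hU, hV, hUV⟩ := ih D
    -- The entries of `U * D * V` are combinations of those of `D`, all divisible by `d`.
    have hdd' : ∀ i, d ∣ d' i := fun i => by
      have h1 : d' i = (U * D * V) i i := by rw [hUV, Matrix.diagonal_apply_eq]
      rw [h1, Matrix.mul_apply]
      refine Finset.dvd_sum fun j _ => Dvd.dvd.mul_right ?_ _
      rw [Matrix.mul_apply]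
      exact Finset.dvd_sum fun l _ => (hdD l j).mul_left _
    refine ⟨Fin.cons d d', ?_, ?_⟩
    · intro i j hij
      induction i using Fin.cases with
      | zero =>
        induction j using Fin.cases with
        | zero => exact dvd_refl _
        | succ j => simpa using hdd' j
      | succ i =>
        induction j using Fin.cases with
        | zero => exact absurd hij (by simp)
        | succ j => simpa using hd' i j (by simpa using hij)
    · have h2 : MatEquiv (Matrix.fromBlocks (Matrix.of fun _ _ => d) 0 0 D)
          (Matrix.fromBlocks (Matrix.of fun _ _ : Unit => d) 0 0 (Matrix.diagonal d')) := by
        refine ⟨Matrix.fromBlocks 1 0 0 U, Matrix.fromBlocks 1 0 0 V, by simpa using hU,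
          by simpa using hV, ?_⟩
        rw [Matrix.fromBlocks_multiply, Matrix.fromBlocks_multiply]
        simp [hUV]
      have h3 := (h.trans h2).of_submatrix e
      have h4 : (A.submatrix e.symm e.symm).submatrix e e = A := by
        ext i j
        simp
      have h5 : (Matrix.fromBlocks (Matrix.of fun _ _ : Unit => d) 0 0
          (Matrix.diagonal d')).submatrix e e = Matrix.diagonal (Fin.cons d d') := by
        ext i j
        induction i using Fin.cases <;> induction j using Fin.cases <;>
          simp [he0, hes, Matrix.diagonal_apply, Fin.succ_ne_zero, (Fin.succ_ne_zero _).symm]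
      rwa [h4, h5] at h3

/-! ### Spectral types of polynomial matrices -/

theorem exists_isDivisorSpectralType {n : Type} [Fintype n] [DecidableEq n] (A : Matrix n n ℂ[X]) :
    ∃ S, IsDivisorSpectralType A S := by
  let e : n ≃ Fin (Fintype.card n) := Fintype.equivFin n
  obtain ⟨d, hd, h⟩ := exists_smith_fin _ (A.submatrix e.symm e.symm)
  obtain ⟨U, V, hU, hV, hUV⟩ := h.of_submatrix e
  -- The order is reversed because `exists_smith_fin` produces an ascending divisibility chain and
  -- the spectral type asks for a descending one.
  refine ⟨_, fun i => d i.rev, e.trans Fin.revPerm, Matrix.GeneralLinearGroup.mk'' U hU,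
    Matrix.GeneralLinearGroup.mk'' V hV, fun i j hij => hd _ _ (Fin.rev_le_rev.mpr hij), ?_, rfl⟩
  have h1 : (A.submatrix e.symm e.symm).submatrix e e = A := by
    ext i j
    simp
  rw [h1] at hUV
  change U * A * V = _
  rw [hUV]
  ext i j
  simp [Matrix.diagonal_apply]

/-- The dimension of the kernel of `A(X)` over `ℂ[X] / (X - a) ^ j`. -/
def divNullity {n : Type*} [Fintype n] (A : Matrix n n ℂ[X]) (a : ℂ) (j : ℕ) : ℕ :=
  Module.finrank ℂ (LinearMap.ker
    ((A.map (Ideal.Quotient.mk (Ideal.span {(X - C a) ^ j})) :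
      Matrix n n (Trunc a j)).mulVecLin.restrictScalars ℂ))

/-- The automorphism defined by an invertible matrix over a `ℂ`-algebra. -/
def glEquiv {n S : Type*} [Fintype n] [DecidableEq n] [CommRing S] [Algebra ℂ S] (U : GL n S) :
    (n → S) ≃ₗ[ℂ] (n → S) :=
  LinearEquiv.ofLinearMap ((U : Matrix n n S).mulVecLin.restrictScalars ℂ)
    (((U⁻¹ : GL n S) : Matrix n n S).mulVecLin.restrictScalars ℂ)
    (by
      refine LinearMap.ext fun x => ?_
      change (U : Matrix n n S).mulVec (((U⁻¹ : GL n S) : Matrix n n S).mulVec x) = x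
      rw [Matrix.mulVec_mulVec, ← Units.val_mul, mul_inv_cancel, Units.val_one, Matrix.one_mulVec])
    (by
      refine LinearMap.ext fun x => ?_
      change ((U⁻¹ : GL n S) : Matrix n n S).mulVec ((U : Matrix n n S).mulVec x) = x
      rw [Matrix.mulVec_mulVec, ← Units.val_mul, inv_mul_cancel, Units.val_one, Matrix.one_mulVec])

/-- The Smith form survives base change to the truncated ring, where `V⁻¹` and `U` carry the kernel
to a product of kernels of scalar multiplications. -/
theorem divNullity_of_smith {n : Type} [Fintype n] [DecidableEq n] {A : Matrix n n ℂ[X]}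
    {d : n → ℂ[X]} (hd : ∀ i, d i ≠ 0) {U V : GL n ℂ[X]}
    (h : (U : Matrix n n ℂ[X]) * A * (V : Matrix n n ℂ[X]) = Matrix.diagonal d) (a : ℂ) (j : ℕ) :
    divNullity A a j = ∑ i, min j ((d i).rootMultiplicity a) := by
  set φ : ℂ[X] →+* Trunc a j := Ideal.Quotient.mk (Ideal.span {(X - C a) ^ j}) with hφ
  have h1 : ∑ i, min j ((d i).rootMultiplicity a) = Module.finrank ℂ (LinearMap.ker
      (LinearMap.piMap fun i => LinearMap.mulLeft ℂ (φ (d i)))) := by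
    rw [finrank_ker_piMap]
    exact Finset.sum_congr rfl fun i _ => (finrank_ker_mulLeft_trunc a j (hd i)).symm
  rw [h1, divNullity]
  refine finrank_ker_eq_of_conj
    (glEquiv (Matrix.GeneralLinearGroup.map φ V)).symm (glEquiv (Matrix.GeneralLinearGroup.map φ U))
    fun x => ?_
  obtain ⟨y, rfl⟩ := (glEquiv (Matrix.GeneralLinearGroup.map φ V)).surjective x
  rw [LinearEquiv.symm_apply_apply]
  change ((U : Matrix n n ℂ[X]).map φ).mulVec ((A.map φ).mulVec
    (((V : Matrix n n ℂ[X]).map φ).mulVec y)) = _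
  rw [Matrix.mulVec_mulVec, Matrix.mulVec_mulVec, ← Matrix.map_mul, ← Matrix.map_mul, h]
  ext i
  rw [Matrix.diagonal_map (map_zero φ), Matrix.mulVec_diagonal]
  rfl

/-- Up to units `det A` is the product of the `d_k`, so its zeros are the points with nonempty
partition. Its nonvanishing excludes `d_k = 0`, for which `rootMultiplicity` takes the default value
`0`. -/
theorem IsDivisorSpectralType.isSpectrum {n : Type} [Fintype n] [DecidableEq n]
    {A : Matrix n n ℂ[X]} {S : Multiset (ℂ × List ℕ)} (h : IsDivisorSpectralType A S)
    (hA : A.det ≠ 0) : IsSpectrum (divNullity A) S := by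
  obtain ⟨d, e, U, V, -, hUV, rfl⟩ := h
  have hdet : (U : Matrix n n ℂ[X]).det * A.det * (V : Matrix n n ℂ[X]).det = ∏ i, d i := by
    rw [← Matrix.det_mul, ← Matrix.det_mul, hUV, Matrix.det_diagonal, Equiv.prod_comp e d]
  have hU : IsUnit (U : Matrix n n ℂ[X]).det := (Matrix.isUnit_iff_isUnit_det _).mp U.isUnit
  have hV : IsUnit (V : Matrix n n ℂ[X]).det := (Matrix.isUnit_iff_isUnit_det _).mp V.isUnit
  have hd : ∀ i, d i ≠ 0 := fun i => by
    refine Finset.prod_ne_zero_iff.mp ?_ i (Finset.mem_univ i)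
    rw [← hdet]
    exact mul_ne_zero (mul_ne_zero hU.ne_zero hA) hV.ne_zero
  refine ⟨_, fun a => conjugate (Finset.univ.val.map fun k => (d k).rootMultiplicity a), rfl,
    fun a => ?_, fun a => ⟨_, rfl, fun j => ?_⟩⟩
  · have h1 : A.det.eval a = 0 ↔ ∃ k, (d k).eval a = 0 := by
      have h2 := congrArg (eval a) hdet
      have hu : ∀ p : ℂ[X], IsUnit p → eval a p ≠ 0 := fun p hp =>
        (hp.map (evalRingHom a)).ne_zero
      rw [eval_mul, eval_mul, eval_prod] at h2
      have h3 : (∃ k, (d k).eval a = 0) ↔ ∏ k, (d k).eval a = 0 := by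
        simp [Finset.prod_eq_zero_iff]
      rw [h3, ← h2]
      simp [hu _ hU, hu _ hV]
    rw [Multiset.mem_toFinset, mem_roots hA, IsRoot.def, h1, Ne, conjugate_eq_nil_iff]
    simp only [Multiset.mem_map, Finset.mem_val, Finset.mem_univ, true_and, forall_exists_index,
      forall_apply_eq_imp_iff, not_forall]
    refine exists_congr fun k => ?_
    rw [rootMultiplicity_eq_zero_iff]
    simp [hd k, IsRoot.def]
  · rw [divNullity_of_smith (fun i => hd (e i)) hUV, truncSum, Multiset.map_map]
    exact (Equiv.sum_comp e fun i => min j ((d i).rootMultiplicity a)).symm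

/-! ### Nullities of `c + u v` and `c + v u` -/

section Swap

variable {n n' : Type*} [Fintype n] [DecidableEq n] [Fintype n'] [DecidableEq n']

theorem mul_mul_pow_mul (u : Matrix n' n ℂ) (v : Matrix n n' ℂ) (j : ℕ) :
    (u * v) ^ (j + 1) = u * ((v * u) ^ j * v) := by
  induction j with
  | zero => simp
  | succ j ih =>
    rw [pow_succ', ih, pow_succ']
    simp only [Matrix.mul_assoc]

/-- In `(u v)^(j+1) = u (v u)^j v` the outer factors preserve the rank of `(v u)^j`, so the
nullities differ by the difference of the sizes. -/
theorem nullity_add_mul_self (c : ℂ) {u : Matrix n' n ℂ} {v : Matrix n n' ℂ}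
    (hu : Function.Injective u.mulVec) (hv : Function.Surjective v.mulVec) (j : ℕ) :
    nullity (c • (1 : Matrix n' n' ℂ) + u * v) c (j + 1) =
      (Fintype.card n' - Fintype.card n) + nullity (c • (1 : Matrix n n ℂ) + v * u) c j := by
  rw [nullity, nullity, finrank_ker_mulVecLin, finrank_ker_mulVecLin, add_sub_cancel_left,
    add_sub_cancel_left, mul_mul_pow_mul]
  have hrank : (u * ((v * u) ^ j * v)).rank = ((v * u) ^ j).rank := by
    rw [Matrix.rank, Matrix.mulVecLin_mul, Matrix.mulVecLin_mul, LinearMap.range_comp,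
      LinearMap.range_comp, LinearMap.range_eq_top.mpr hv, Submodule.map_top]
    exact (Submodule.equivMapOfInjective u.mulVecLin hu _).finrank_eq.symm
  have hcard : Fintype.card n ≤ Fintype.card n' := by
    simpa using LinearMap.finrank_le_finrank_of_injective (f := u.mulVecLin) hu
  have hle := ((v * u) ^ j).rank_le_card_width
  rw [hrank]
  omega

/-- `v` intertwines the two matrices and so maps one kernel into the other. On `ker v` the larger
matrix is the scalar `c ≠ α`, so `v` is injective on the kernel of `M ^ j`. Exchanging `u` and `v`
gives the opposite inequality. -/
theorem nullity_add_mul_le {c α : ℂ} (h : α ≠ c) (u : Matrix n' n ℂ) (v : Matrix n n' ℂ) (j : ℕ) :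
    nullity (c • (1 : Matrix n' n' ℂ) + u * v) α j ≤
      nullity (c • (1 : Matrix n n ℂ) + v * u) α j := by
  set M := c • (1 : Matrix n' n' ℂ) + u * v - α • (1 : Matrix n' n' ℂ) with hM
  set K := c • (1 : Matrix n n ℂ) + v * u - α • (1 : Matrix n n ℂ) with hK
  have hvM : v * M = K * v := by
    simp only [hM, hK, Matrix.mul_sub, Matrix.sub_mul, Matrix.mul_add, Matrix.add_mul,
      Matrix.mul_smul, Matrix.smul_mul, Matrix.mul_one, Matrix.one_mul, Matrix.mul_assoc]
  have hvMj : ∀ j, v * M ^ j = K ^ j * v := fun j => by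
    induction j with
    | zero => simp
    | succ j ih => rw [pow_succ, ← Matrix.mul_assoc, ih, Matrix.mul_assoc, hvM, ← Matrix.mul_assoc,
        pow_succ]
  have hscal : ∀ x, v.mulVec x = 0 → ∀ j, (M ^ j).mulVec x = (c - α) ^ j • x := fun x hx j => by
    have h1 : M.mulVec x = (c - α) • x := by
      rw [hM, Matrix.sub_mulVec, Matrix.add_mulVec, ← Matrix.mulVec_mulVec, hx, Matrix.mulVec_zero,
        Matrix.smul_mulVec, Matrix.smul_mulVec, Matrix.one_mulVec, add_zero, sub_smul]
    induction j with
    | zero => simp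
    | succ j ih => rw [pow_succ, ← Matrix.mulVec_mulVec, h1, Matrix.mulVec_smul, ih, smul_smul,
        pow_succ']
  have hmaps : ∀ x ∈ LinearMap.ker (M ^ j).mulVecLin,
      v.mulVecLin x ∈ LinearMap.ker (K ^ j).mulVecLin := fun x hx => by
    rw [LinearMap.mem_ker, Matrix.mulVecLin_apply] at hx ⊢
    rw [Matrix.mulVecLin_apply, Matrix.mulVec_mulVec, ← hvMj, ← Matrix.mulVec_mulVec, hx,
      Matrix.mulVec_zero]
  refine LinearMap.finrank_le_finrank_of_injective (f := v.mulVecLin.restrict hmaps) ?_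
  rw [injective_iff_map_eq_zero]
  rintro ⟨x, hx⟩ hvx
  have hvx' : v.mulVec x = 0 := congrArg Subtype.val hvx
  have h2 : (M ^ j).mulVec x = 0 := hx
  rw [hscal x hvx' j, smul_eq_zero] at h2
  exact Subtype.ext (h2.resolve_left (pow_ne_zero _ (sub_ne_zero.mpr h.symm)))

theorem nullity_add_mul_of_ne {c α : ℂ} (h : α ≠ c) (u : Matrix n' n ℂ) (v : Matrix n n' ℂ)
    (j : ℕ) :
    nullity (c • (1 : Matrix n' n' ℂ) + u * v) α j =
      nullity (c • (1 : Matrix n n ℂ) + v * u) α j :=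
  le_antisymm (nullity_add_mul_le h u v j) (nullity_add_mul_le h v u j)

theorem isUnit_iff_nullity_zero (M : Matrix n n ℂ) : IsUnit M ↔ nullity M 0 1 = 0 := by
  rw [nullity, zero_smul, sub_zero, pow_one, Submodule.finrank_eq_zero, LinearMap.ker_eq_bot]
  exact Matrix.mulVec_injective_iff_isUnit.symm

theorem isUnit_add_mul_comm {c : ℂ} (hc : c ≠ 0) (u : Matrix n' n ℂ) (v : Matrix n n' ℂ)
    (h : IsUnit (c • (1 : Matrix n n ℂ) + v * u)) : IsUnit (c • (1 : Matrix n' n' ℂ) + u * v) := by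
  rw [isUnit_iff_nullity_zero] at h ⊢
  rw [nullity_add_mul_of_ne hc.symm, h]

end Swap

namespace System

variable {n : Type} {N : ℕ}

/-! ### The coefficients of an equation and of its convolution -/

/-- `∏ j ≠ i, (1 - x / b_j)`. -/
def Tdel (E : System n N) (i : Fin N) : ℂ[X] :=
  ∏ j ∈ Finset.univ.erase i, (1 - C (E.b j)⁻¹ * X)

theorem T_eq (E : System n N) (i : Fin N) : E.T = (1 - C (E.b i)⁻¹ * X) * E.Tdel i :=
  (Finset.mul_prod_erase Finset.univ _ (Finset.mem_univ i)).symm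

theorem eval_T_zero (E : System n N) : E.T.eval 0 = 1 := by
  simp [T, eval_prod]

theorem eval_factor_eq_zero_iff (E : System n N) (i : Fin N) (a : ℂ) :
    (1 - C (E.b i)⁻¹ * X : ℂ[X]).eval a = 0 ↔ a = E.b i := by
  have h := E.b_ne_zero i
  simp only [eval_sub, eval_one, eval_mul, eval_C, eval_X, sub_eq_zero]
  rw [eq_comm, inv_mul_eq_one₀ h, eq_comm]

theorem eval_T_eq_zero_iff (E : System n N) (a : ℂ) : E.T.eval a = 0 ↔ ∃ i, a = E.b i := by
  rw [T, eval_prod, Finset.prod_eq_zero_iff]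
  simp only [Finset.mem_univ, true_and, eval_factor_eq_zero_iff]

theorem eval_Tdel_ne_zero (E : System n N) {i : Fin N} {a : ℂ}
    (h : ∀ j, j ≠ i → a ≠ E.b j) : (E.Tdel i).eval a ≠ 0 := by
  rw [Tdel, eval_prod, Finset.prod_ne_zero_iff]
  intro j hj
  rw [Ne, eval_factor_eq_zero_iff]
  exact h j (Finset.ne_of_mem_erase hj)

theorem coeff_T (E : System n N) : E.T.coeff N = E.binf := by
  have h := coeff_prod_of_natDegree_le (s := Finset.univ)
    (fun i : Fin N => (1 - C (E.b i)⁻¹ * X : ℂ[X])) 1 (fun i _ => by compute_degree)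
  rw [Finset.card_univ, Fintype.card_fin, mul_one] at h
  rw [T, h, binf]
  refine Finset.prod_congr rfl fun i _ => ?_
  simp [coeff_one]

theorem coeff_Tdel (E : System n N) (i : Fin N) : (E.Tdel i).coeff N = 0 := by
  refine coeff_eq_zero_of_natDegree_lt ?_
  calc (E.Tdel i).natDegree
      ≤ ∑ j ∈ Finset.univ.erase i, (1 - C (E.b j)⁻¹ * X : ℂ[X]).natDegree :=
        natDegree_prod_le _ _
    _ ≤ (Finset.univ.erase i).card • 1 := Finset.sum_le_card_nsmul _ _ _ fun j _ => by
        compute_degree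
    _ < N := by
        have := i.2
        rw [Finset.card_erase_of_mem (Finset.mem_univ i), Finset.card_univ, Fintype.card_fin]
        simp
        omega

theorem binf_ne_zero (E : System n N) : E.binf ≠ 0 :=
  Finset.prod_ne_zero_iff.mpr fun i _ => neg_ne_zero.mpr (inv_ne_zero (E.b_ne_zero i))

theorem Ainf_eq (E : System n N) : E.Ainf = E.binf • E.Binf := by
  ext k l
  simp only [Ainf, A, Matrix.map_apply, Matrix.add_apply, Matrix.smul_apply, Matrix.sum_apply,
    smul_eq_mul, coeff_add, coeff_mul_C, finsetSum_coeff, coeff_T]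
  have h := fun i => E.coeff_Tdel i
  simp only [Tdel] at h
  simp [h]

variable [DecidableEq n]

/-- The inclusion of the block of index `0`. -/
def headEmb (n : Type) [DecidableEq n] (N : ℕ) : Matrix (Fin (N + 1) × n) n ℂ :=
  Matrix.of fun s k => if s.1 = 0 ∧ s.2 = k then 1 else 0

/-- The diagonal inclusion into all blocks. -/
def diagEmb (n : Type) [DecidableEq n] (N : ℕ) : Matrix (Fin (N + 1) × n) n ℂ :=
  Matrix.of fun s k => if s.2 = k then 1 else 0

theorem Binf_eq (E : System n N) : E.Binf = 1 - ∑ j, E.res j := by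
  rw [Fin.sum_univ_succ]
  simp [res, B0]

theorem sum_F_zero (E : System n N) (c : ℂ) (k : n) (t : Fin (N + 1) × n) :
    ∑ i, E.F c i (0, k) t = 0 :=
  Finset.sum_eq_zero fun i _ => by simp [F, (Fin.succ_ne_zero i).symm]

theorem F_succ (E : System n N) (c : ℂ) (i j : Fin N) (k : n) (t : Fin (N + 1) × n) :
    E.F c i (j.succ, k) t = if j = i then
      E.res t.1 k t.2 - (1 - c) * (1 : Matrix (Fin (N + 1) × n) (Fin (N + 1) × n) ℂ) (j.succ, k) t
      else 0 := by
  by_cases hij : j = i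
  · subst hij
    obtain ⟨l, k'⟩ := t
    by_cases hl : l = j.succ
    · subst hl
      simp [F, Matrix.one_apply]
    · simp [F, hl, Ne.symm hl]
  · simp [F, hij]

theorem Azero_eq (E : System n N) : E.Azero = 1 - E.B0 := by
  have h : E.Azero = E.A.map (eval 0) := by
    ext k l
    simp [Azero, coeff_zero_eq_eval_zero]
  rw [h, eval_A E 0 fun i => (E.b_ne_zero i).symm, eval_T_zero, one_smul, rat, B0]
  simp only [zero_div, sub_zero, inv_one, one_smul]
  abel

theorem conv_Ainf (E : System n N) (q lam : ℂ) :
    (E.conv q lam).Ainf = E.binf • (1 - E.Fhat) :=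
  Ainf_eq _

variable [Fintype n]

/-- The block row `(B_0, …, B_i + τ, …, B_N)`. -/
def blockRow (E : System n N) (i : Fin (N + 1)) (τ : ℂ) : Matrix n (Fin (N + 1) × n) ℂ :=
  Matrix.of fun k t => (E.res t.1 + if t.1 = i then τ • (1 : Matrix n n ℂ) else 0) k t.2

theorem blockRow_mulVec (E : System n N) (i : Fin (N + 1)) (τ : ℂ) (w : Fin (N + 1) × n → ℂ) :
    (E.blockRow i τ).mulVec w =
      ∑ j, (E.res j).mulVec (fun k => w (j, k)) + τ • fun k => w (i, k) := by
  ext k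
  simp only [Matrix.mulVec, dotProduct, blockRow, Matrix.of_apply, Matrix.add_apply, add_mul,
    Finset.sum_add_distrib, Fintype.sum_prod_type, Pi.add_apply, Finset.sum_apply]
  congr 1
  rw [Finset.sum_eq_single i]
  · rw [Finset.sum_eq_single k]
    · simp
    · intro l _ hl
      simp [Matrix.one_apply_ne hl.symm]
    · simp
  · intro j _ hj
    simp [hj]
  · simp

/-- Vectors supported in a single block already produce the ranges of `B_j`, `j ≠ i`, and of `B_i +
τ`, which span by (∗∗). -/
theorem StarStar.blockRow_surjective {E : System n N} (h : E.StarStar) (i : Fin (N + 1)) (τ : ℂ) :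
    Function.Surjective (E.blockRow i τ).mulVec := by
  have key : LinearMap.range (E.blockRow i τ).mulVecLin = ⊤ := by
    have hpart : ∀ (j : Fin (N + 1)) (x : n → ℂ), (E.blockRow i τ).mulVec
        (fun t => if t.1 = j then x t.2 else 0) =
          (E.res j + if j = i then τ • (1 : Matrix n n ℂ) else 0).mulVec x := fun j x => by
      rw [blockRow_mulVec, Finset.sum_eq_single j]
      · by_cases hij : j = i
        · subst hij
          simp [Matrix.add_mulVec, Matrix.smul_mulVec]
        · have hij' : i ≠ j := fun e => hij e.symm
          simp only [hij, hij', if_true, if_false, add_zero]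
          rw [show (fun _ : n => (0 : ℂ)) = 0 from rfl, smul_zero, add_zero]
      · intro l _ hl
        simp only [hl, if_false]
        exact Matrix.mulVec_zero _
      · simp
    rw [eq_top_iff, ← h i τ, sup_le_iff]
    constructor
    · refine iSup₂_le fun j hj => ?_
      rintro _ ⟨x, rfl⟩
      refine ⟨_, (hpart j x).trans ?_⟩
      simp [hj]
    · rintro _ ⟨x, rfl⟩
      exact ⟨_, (hpart i x).trans (by rw [if_pos rfl]; rfl)⟩
  exact LinearMap.range_eq_top.mp key

/-- In block row `i ≥ 1` the entries `B_j` of `F̂` and `F_i` cancel and leave the scalar `q ^ lam`;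
only block row `0` deviates from it. -/
theorem conv_Azero (E : System n N) (q lam : ℂ) :
    (E.conv q lam).Azero = q ^ lam • (1 : Matrix (Fin (N + 1) × n) (Fin (N + 1) × n) ℂ) +
      headEmb n N *
        -E.blockRow 0 (q ^ lam - 1) := by
  have hB0 : (E.conv q lam).B0 = E.Fhat - ∑ i, E.F (q ^ lam) i := by
    simp [B0, conv]
  rw [Azero_eq, hB0]
  ext ⟨j, k⟩ t
  have hmul : (headEmb n N *
        -E.blockRow 0 (q ^ lam - 1)) (j, k) t =
      if j = 0 then -E.blockRow 0 (q ^ lam - 1) k t else 0 := by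
    rw [Matrix.mul_apply]
    by_cases hj : j = 0 <;> simp [headEmb, hj]
  rw [Matrix.add_apply, hmul]
  induction j using Fin.cases with
  | zero =>
    obtain ⟨l, k'⟩ := t
    simp only [Matrix.sub_apply, Matrix.sum_apply, sum_F_zero, if_true, blockRow,
      Matrix.of_apply, Fhat, Matrix.smul_apply, smul_eq_mul, Matrix.add_apply]
    by_cases hl : l = 0
    · subst hl
      simp only [Matrix.one_apply, Matrix.smul_apply, smul_eq_mul, if_true, Prod.mk.injEq, true_and]
      split_ifs <;> ring
    · simp [hl, Ne.symm hl]
  | succ j =>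
    simp only [Matrix.sub_apply, Matrix.sum_apply, F_succ, Finset.sum_ite_eq, Finset.mem_univ,
      if_true, Fin.succ_ne_zero, if_false, Fhat, Matrix.of_apply, Matrix.smul_apply, smul_eq_mul]
    ring

/-- The two factors of `conv_Azero` in the opposite order. `conv_Ainf_eq_add_mul` and
`Ainf_eq_add_mul` form the same kind of pair, with `diagEmb` in place of `headEmb`. -/
theorem Azero_eq_add_mul (E : System n N) (c : ℂ) :
    E.Azero = c • (1 : Matrix n n ℂ) + -E.blockRow 0 (c - 1) *
      headEmb n N := by
  rw [Azero_eq]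
  ext k l
  rw [Matrix.add_apply, Matrix.mul_apply, Finset.sum_eq_single (0, l)]
  · simp [blockRow, res, headEmb]
    ring
  · rintro ⟨j, k'⟩ _ h
    rw [headEmb, Matrix.of_apply, if_neg, mul_zero]
    rintro ⟨h1, h2⟩
    exact h (Prod.ext h1 h2)
  · simp

theorem conv_Ainf_eq_add_mul (E : System n N) (q lam : ℂ) :
    (E.conv q lam).Ainf = E.binf • (1 : Matrix (Fin (N + 1) × n) (Fin (N + 1) × n) ℂ) +
      diagEmb n N * (-E.binf • E.blockRow 0 0) := by
  rw [conv_Ainf]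
  ext ⟨j, k⟩ t
  rw [Matrix.add_apply, Matrix.mul_apply, Finset.sum_eq_single k]
  · simp [Fhat, blockRow, diagEmb]
    ring
  · intro l _ hl
    simp [diagEmb, hl.symm]
  · simp

theorem Ainf_eq_add_mul (E : System n N) :
    E.Ainf = E.binf • (1 : Matrix n n ℂ) + (-E.binf • E.blockRow 0 0) *
      diagEmb n N := by
  rw [Ainf_eq, Binf_eq]
  ext k l
  rw [Matrix.add_apply, Matrix.mul_apply, Fintype.sum_prod_type]
  simp only [diagEmb, Matrix.of_apply, mul_ite, mul_one, mul_zero, Finset.sum_ite_eq', Finset.mem_univ,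
    if_true]
  simp [blockRow, Matrix.sum_apply, ← Finset.mul_sum]
  ring

end System

/-! ### Units and reductions in truncated polynomial rings -/

theorem isUnit_trunc_mk {a : ℂ} {p : ℂ[X]} (h : p.eval a ≠ 0) (j : ℕ) :
    IsUnit (Ideal.Quotient.mk (Ideal.span {(X - C a) ^ j}) p : Trunc a j) := by
  have h1 : IsCoprime ((X - C a) ^ j) p :=
    ((irreducible_X_sub_C a).coprime_iff_not_dvd.mpr (by rwa [dvd_iff_isRoot])).pow_left
  obtain ⟨u, v, huv⟩ := h1
  refine IsUnit.of_mul_eq_one (Ideal.Quotient.mk _ v) ?_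
  rw [← map_mul, ← map_one (Ideal.Quotient.mk _), Ideal.Quotient.eq, Ideal.mem_span_singleton]
  exact ⟨-u, by linear_combination huv⟩

/-- The reduction `ℂ[X] / (X - a) ^ (j + 1) → ℂ[X] / (X - a) ^ j`. -/
def truncRed (a : ℂ) (j : ℕ) : Trunc a (j + 1) →ₐ[ℂ] Trunc a j :=
  Ideal.Quotient.factorₐ ℂ (by
    rw [Ideal.span_singleton_le_span_singleton]
    exact pow_dvd_pow _ (Nat.le_succ j))

theorem truncRed_mk (a : ℂ) (j : ℕ) (p : ℂ[X]) :
    truncRed a j (Ideal.Quotient.mk _ p) = Ideal.Quotient.mk _ p := rfl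

theorem truncRed_surjective (a : ℂ) (j : ℕ) : Function.Surjective (truncRed a j) := fun y => by
  obtain ⟨p, rfl⟩ := Ideal.Quotient.mk_surjective y
  exact ⟨Ideal.Quotient.mk _ p, rfl⟩

theorem truncRed_eq_zero_iff_mul {a : ℂ} {j : ℕ} (z : Trunc a (j + 1)) :
    truncRed a j z = 0 ↔ Ideal.Quotient.mk (Ideal.span {(X - C a) ^ (j + 1)}) (X - C a) * z = 0 := by
  obtain ⟨p, rfl⟩ := Ideal.Quotient.mk_surjective z
  rw [truncRed_mk, ← map_mul, Ideal.Quotient.eq_zero_iff_mem, Ideal.Quotient.eq_zero_iff_mem,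
    Ideal.mem_span_singleton, Ideal.mem_span_singleton, pow_succ',
    mul_dvd_mul_iff_left (X_sub_C_ne_zero a)]

/-- A simple zero at `a` costs exactly one order of precision. -/
theorem mk_mul_eq_zero_iff {a : ℂ} {j : ℕ} {u : ℂ[X]} (hu : u.eval a ≠ 0) (z : Trunc a (j + 1)) :
    Ideal.Quotient.mk (Ideal.span {(X - C a) ^ (j + 1)}) ((X - C a) * u) * z = 0 ↔
      truncRed a j z = 0 := by
  rw [truncRed_eq_zero_iff_mul, mul_comm (X - C a) u, map_mul, mul_assoc]
  exact (isUnit_trunc_mk hu _).mul_right_eq_zero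

/-- The class of `(X - a) ^ j` in `ℂ[X] / (X - a) ^ (j + 1)`. -/
def truncTop (a : ℂ) (j : ℕ) : Trunc a (j + 1) := Ideal.Quotient.mk _ ((X - C a) ^ j)

theorem truncRed_truncTop (a : ℂ) (j : ℕ) : truncRed a j (truncTop a j) = 0 := by
  rw [truncTop, truncRed_mk, Ideal.Quotient.eq_zero_iff_mem]
  exact Ideal.mem_span_singleton_self _

theorem mk_mul_truncTop (a : ℂ) (j : ℕ) (p : ℂ[X]) :
    Ideal.Quotient.mk (Ideal.span {(X - C a) ^ (j + 1)}) p * truncTop a j =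
      p.eval a • truncTop a j := by
  rw [truncTop, smul_trunc_mk, ← map_mul, Ideal.Quotient.eq, Ideal.mem_span_singleton, pow_succ',
    ← sub_mul]
  exact mul_dvd_mul_right (X_sub_C_dvd_sub_C_eval) _

theorem exists_smul_truncTop {a : ℂ} {j : ℕ} {z : Trunc a (j + 1)} (h : truncRed a j z = 0) :
    ∃ r : ℂ, z = r • truncTop a j := by
  obtain ⟨p, rfl⟩ := Ideal.Quotient.mk_surjective z
  rw [truncRed_mk, Ideal.Quotient.eq_zero_iff_mem, Ideal.mem_span_singleton] at h
  obtain ⟨g, rfl⟩ := h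
  exact ⟨g.eval a, by rw [← mk_mul_truncTop, mul_comm, map_mul]; rfl⟩

theorem smul_truncTop_eq_zero {a : ℂ} {j : ℕ} {r : ℂ} (h : r • truncTop a j = 0) : r = 0 := by
  rw [truncTop, smul_trunc_mk, Ideal.Quotient.eq_zero_iff_mem, Ideal.mem_span_singleton, pow_succ',
    mul_dvd_mul_iff_right (pow_ne_zero _ (X_sub_C_ne_zero a)), dvd_iff_isRoot] at h
  simpa using h

/-- The substitution `X ↦ c⁻¹ X`, from `ℂ[X] / (X - a) ^ j` to `ℂ[X] / (X - c a) ^ j`. -/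
theorem exists_truncScale {c : ℂ} (hc : c ≠ 0) (a : ℂ) (j : ℕ) :
    ∃ σ : Trunc a j ≃ₐ[ℂ] Trunc (c * a) j,
      σ (Ideal.Quotient.mk _ X) = c⁻¹ • Ideal.Quotient.mk _ X := by
  have : Invertible c⁻¹ := invertibleOfNonzero (inv_ne_zero hc)
  refine ⟨Ideal.quotientEquivAlg _ _ (algEquivCMulXAddC c⁻¹ 0) ?_, ?_⟩
  · rw [Ideal.map_span, Set.image_singleton, Ideal.span_singleton_eq_span_singleton]
    have h : (algEquivCMulXAddC c⁻¹ 0) ((X - C a) ^ j) = C (c⁻¹ ^ j) * (X - C (c * a)) ^ j := by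
      rw [map_pow, map_sub, algEquivCMulXAddC_apply, algEquivCMulXAddC_apply, aeval_X, aeval_C,
        C_pow, ← mul_pow, mul_sub, ← C_mul, inv_mul_cancel_left₀ hc]
      simp
    refine (Associated.trans (y := C (c⁻¹ ^ j) * (X - C (c * a)) ^ j) ?_ ?_)
    · exact (associated_unit_mul_left _ _
        (isUnit_C.mpr (pow_ne_zero _ (inv_ne_zero hc)).isUnit)).symm
    · rw [← h]
      exact Associated.refl _
  · change Ideal.Quotient.mk _ (algEquivCMulXAddC c⁻¹ 0 X) = _
    rw [algEquivCMulXAddC_apply, aeval_X, C_0, add_zero]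
    exact (smul_trunc_mk _ _ _ _).symm

namespace System

variable {n : Type} {N : ℕ}

/-! ### The common factor of an equation and of its convolution -/

theorem exists_Tdel_factor (E : System n N) {i j : Fin N} (h : i ≠ j) :
    ∃ u : ℂ[X], E.Tdel i = (1 - C (E.b j)⁻¹ * X) * u ∧ E.Tdel j = (1 - C (E.b i)⁻¹ * X) * u := by
  refine ⟨∏ k ∈ (Finset.univ.erase i).erase j, (1 - C (E.b k)⁻¹ * X), ?_, ?_⟩
  · exact (Finset.mul_prod_erase _ _ (Finset.mem_erase.mpr ⟨h.symm, Finset.mem_univ j⟩)).symm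
  · rw [Finset.erase_right_comm]
    exact (Finset.mul_prod_erase _ _ (Finset.mem_erase.mpr ⟨h, Finset.mem_univ i⟩)).symm

/-- A root of `T` is some `b_i`, and `X * T_i` does not vanish there, so these polynomials have no
common root. -/
theorem exists_bezout (E : System n N) : ∃ (p₀ : ℂ[X]) (p : Fin N → ℂ[X]),
    p₀ * E.T + ∑ j, p j * (X * E.Tdel j) = 1 := by
  let r : Fin (N + 1) → ℂ[X] := Fin.cons E.T fun j => X * E.Tdel j
  have htop : Ideal.span (Set.range r) = ⊤ := by
    obtain ⟨g, hg⟩ := IsPrincipalIdealRing.principal (Ideal.span (Set.range r))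
    have hdvd : ∀ i, g ∣ r i := fun i => by
      rw [← Ideal.mem_span_singleton]
      have h1 := Ideal.subset_span (Set.mem_range_self (f := r) i)
      rwa [hg] at h1
    rw [hg]
    refine Ideal.span_singleton_eq_top.mpr ?_
    by_contra hu
    have hT : E.T ≠ 0 := fun h0 => by
      have h1 := E.eval_T_zero
      rw [h0, eval_zero] at h1
      exact zero_ne_one h1
    have hg0 : g ≠ 0 := fun h0 => hT (zero_dvd_iff.mp (h0 ▸ hdvd 0))
    obtain ⟨a, ha⟩ := IsAlgClosed.exists_root g fun h0 =>
      hu (isUnit_iff_degree_eq_zero.mpr h0)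
    have hroot : ∀ i, (r i).eval a = 0 := fun i => by
      obtain ⟨s, hs⟩ := hdvd i
      rw [hs, eval_mul, ha.eq_zero, zero_mul]
    obtain ⟨i, rfl⟩ := (E.eval_T_eq_zero_iff a).mp (hroot 0)
    have h1 : (X * E.Tdel i).eval (E.b i) = 0 := hroot i.succ
    rw [eval_mul, eval_X] at h1
    exact mul_ne_zero (E.b_ne_zero i)
      (E.eval_Tdel_ne_zero fun j hj e => hj (E.b_injective e.symm)) h1
  obtain ⟨p, hp⟩ := Ideal.mem_span_range_iff_exists_fun.mp (htop ▸ Submodule.mem_top (x := 1))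
  refine ⟨p 0, fun j => p j.succ, ?_⟩
  rw [← hp, Fin.sum_univ_succ]
  rfl

section Factor

variable {R R' : Type*} [CommRing R] [Algebra ℂ R] [CommRing R'] [Algebra ℂ R']

/-- The diagonal coefficients `1, 1 - y / b_1, …, 1 - y / b_N`. -/
def diagCoeff (E : System n N) (y : R) : Fin (N + 1) → R :=
  Fin.cons 1 fun i => 1 - algebraMap ℂ R (E.b i)⁻¹ * y

/-- The coefficients `-1, y / b_1, …, y / b_N` of the block rows. -/
def rowCoeff (E : System n N) (y : R) : Fin (N + 1) → R :=
  Fin.cons (-1) fun i => algebraMap ℂ R (E.b i)⁻¹ * y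

/-- The row factors `T, c T_1, …, c T_N`, `T_i = ∏ j ≠ i, (1 - x / b_j)`. -/
def rowFactor (E : System n N) (c : ℂ) : Fin (N + 1) → ℂ[X] :=
  Fin.cons E.T fun i => C c * E.Tdel i

/-- The parametrization of the kernel of `core` by the kernel of `A`. -/
def param (E : System n N) (φ : ℂ[X] →ₐ[ℂ] R) : (n → R) →ₗ[ℂ] (Fin (N + 1) × n → R) :=
  LinearMap.pi fun s => LinearMap.mulLeft ℂ
    (φ ((Fin.cons E.T fun j => -(C (E.b j)⁻¹ * X * E.Tdel j) : Fin (N + 1) → ℂ[X]) s.1)) ∘ₗ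
      LinearMap.proj s.2

theorem param_zero (E : System n N) (φ : ℂ[X] →ₐ[ℂ] R) (z : n → R) (k : n) :
    E.param φ z (0, k) = φ E.T * z k := rfl

theorem param_succ (E : System n N) (φ : ℂ[X] →ₐ[ℂ] R) (z : n → R) (j : Fin N) (k : n) :
    E.param φ z (j.succ, k) = -(algebraMap ℂ R (E.b j)⁻¹ * φ X * φ (E.Tdel j)) * z k := by
  change φ (-(C (E.b j)⁻¹ * X * E.Tdel j)) * z k = _
  rw [map_neg, map_mul, map_mul]
  congr 4
  exact φ.commutes _

variable [DecidableEq n]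

/-- The matrix whose block rows are `1 e_0 - (B_0 … B_N)` and
`(1 - y / b_i) e_i + (y / b_i) (B_0 … B_N)`. -/
def core (E : System n N) (y : R) : Matrix (Fin (N + 1) × n) (Fin (N + 1) × n) R :=
  Matrix.of fun s t => E.diagCoeff y s.1 * (1 : Matrix _ _ R) s t +
    E.rowCoeff y s.1 * algebraMap ℂ R (E.res t.1 s.2 t.2)

theorem core_map (E : System n N) (φ : R →ₐ[ℂ] R') (y : R) : (E.core y).map φ = E.core (φ y) := by
  ext s t
  simp only [core, Matrix.map_apply, Matrix.of_apply, map_add, map_mul, AlgHom.commutes]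
  have h1 : φ (E.diagCoeff y s.1) = E.diagCoeff (φ y) s.1 := by
    cases s.1 using Fin.cases <;> simp [diagCoeff]
  have h2 : φ (E.rowCoeff y s.1) = E.rowCoeff (φ y) s.1 := by
    cases s.1 using Fin.cases <;> simp [rowCoeff]
  rw [h1, h2, Matrix.one_apply, Matrix.one_apply]
  split_ifs <;> simp

/-- Put `x = c y` and let `B` be the row `(B_0 … B_N)`. Row `i` of `G` is `T (e_i - B) + T_i (B - (1
- c) e_i)`. Since `T = (1 - x/b_i) T_i`, it equals `c T_i ((1 - y/b_i) e_i + (y/b_i) B)`. -/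
theorem conv_A_map (E : System n N) {q lam : ℂ} (φ : ℂ[X] →ₐ[ℂ] R) {y : R}
    (hy : φ X = (q ^ lam) • y) (s t : Fin (N + 1) × n) :
    (E.conv q lam).A.map φ s t = φ (E.rowFactor (q ^ lam) s.1) * E.core y s t := by
  have hA : (E.conv q lam).A s t = E.T * C ((1 - E.Fhat) s t) +
      ∑ i, E.Tdel i * C (E.F (q ^ lam) i s t) := by
    simp only [A, Matrix.add_apply, Matrix.smul_apply, Matrix.sum_apply, Matrix.map_apply,
      smul_eq_mul]
    rfl
  have hC : ∀ z : ℂ, φ (C z) = algebraMap ℂ R z := fun z => φ.commutes z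
  have hone : ∀ s t : Fin (N + 1) × n, algebraMap ℂ R ((1 : Matrix _ _ ℂ) s t) =
      (1 : Matrix _ _ R) s t := fun s t => by
    rw [Matrix.one_apply, Matrix.one_apply]
    split_ifs <;> simp
  obtain ⟨j, k⟩ := s
  rw [Matrix.map_apply, hA]
  induction j using Fin.cases with
  | zero =>
    have h0 : ∑ i, E.Tdel i * C (E.F (q ^ lam) i (0, k) t) = 0 :=
      Finset.sum_eq_zero fun i _ => by simp [F, (Fin.succ_ne_zero i).symm]
    rw [h0, add_zero, map_mul, hC, Matrix.sub_apply, map_sub, hone]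
    simp [rowFactor, core, diagCoeff, rowCoeff, Fhat]
    ring
  | succ i =>
    have h1 : ∑ l, E.Tdel l * C (E.F (q ^ lam) l (i.succ, k) t) = E.Tdel i *
        C (E.res t.1 k t.2 - (1 - q ^ lam) * (1 : Matrix _ _ ℂ) (i.succ, k) t) := by
      rw [Finset.sum_eq_single i]
      · rw [F_succ, if_pos rfl]
      · intro l _ hl
        rw [F_succ, if_neg hl.symm, C_0, mul_zero]
      · simp
    rw [h1, map_add, map_mul, map_mul, hC, hC, T_eq E i, map_mul, map_sub, map_mul, map_one, hC, hy,
      Matrix.sub_apply, map_sub, map_sub, map_mul, map_sub, map_one, hone]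
    simp only [rowFactor, core, diagCoeff, rowCoeff, Fhat, Matrix.of_apply, Fin.cons_succ, map_mul,
      hC, Algebra.smul_def]
    ring

variable [Fintype n]

/-- `∑ j, B_j w_j`. -/
def blockSum (E : System n N) (w : Fin (N + 1) × n → R) (k : n) : R :=
  ∑ t, algebraMap ℂ R (E.res t.1 k t.2) * w t

theorem core_mulVec (E : System n N) (y : R) (w : Fin (N + 1) × n → R) (s : Fin (N + 1) × n) :
    (E.core y).mulVec w s = E.diagCoeff y s.1 * w s + E.rowCoeff y s.1 * E.blockSum w s.2 := by
  simp only [Matrix.mulVec, dotProduct, core, Matrix.of_apply, add_mul, Finset.sum_add_distrib,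
    blockSum, Finset.mul_sum, mul_assoc]
  congr 1
  rw [Finset.sum_eq_single s]
  · simp
  · intro t _ ht
    simp [Matrix.one_apply_ne ht.symm]
  · simp

theorem conv_A_mulVec (E : System n N) {q lam : ℂ} (φ : ℂ[X] →ₐ[ℂ] R) {y : R}
    (hy : φ X = (q ^ lam) • y) (w : Fin (N + 1) × n → R) (s : Fin (N + 1) × n) :
    ((E.conv q lam).A.map φ).mulVec w s =
      φ (E.rowFactor (q ^ lam) s.1) * (E.core y).mulVec w s := by
  simp only [Matrix.mulVec, dotProduct, E.conv_A_map φ hy, Finset.mul_sum, mul_assoc]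

/-- Substituting `B_∞ = 1 - ∑ B_j` gives `A = T - T B_0 + ∑ (T_j - T) B_j`, and `T_j - T = (x/b_j)
T_j`; these are the coefficients built into `param`. -/
theorem A_mulVec (E : System n N) (φ : ℂ[X] →ₐ[ℂ] R) (z : n → R) (k : n) :
    (E.A.map φ).mulVec z k = E.param φ z (0, k) - E.blockSum (E.param φ z) k := by
  have hA : ∀ l, φ (E.A k l) = φ E.T * (1 : Matrix n n R) k l - φ E.T * algebraMap ℂ R (E.res 0 k l) +
      ∑ j : Fin N, algebraMap ℂ R (E.b j)⁻¹ * φ X * φ (E.Tdel j) *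
        algebraMap ℂ R (E.res j.succ k l) := fun l => by
    have h1 : E.A k l = E.T * C (E.Binf k l) + ∑ i, E.Tdel i * C (E.B i k l) := by
      simp only [A, Matrix.add_apply, Matrix.smul_apply, Matrix.sum_apply, Matrix.map_apply,
        smul_eq_mul]
      rfl
    have hC : ∀ z : ℂ, φ (C z) = algebraMap ℂ R z := fun z => φ.commutes z
    have hone : algebraMap ℂ R ((1 : Matrix _ _ ℂ) k l) = (1 : Matrix _ _ R) k l := by
      rw [Matrix.one_apply, Matrix.one_apply]
      split_ifs <;> simp
    have hres : ∀ j : Fin N, E.res j.succ = E.B j := fun j => rfl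
    have hT : ∀ j, φ E.T = (1 - algebraMap ℂ R (E.b j)⁻¹ * φ X) * φ (E.Tdel j) := fun j => by
      rw [T_eq E j, map_mul, map_sub, map_mul, map_one, hC]
    have h2 : ∀ j, φ (E.Tdel j) * algebraMap ℂ R (E.B j k l) =
        algebraMap ℂ R (E.b j)⁻¹ * φ X * φ (E.Tdel j) * algebraMap ℂ R (E.B j k l) +
          φ E.T * algebraMap ℂ R (E.B j k l) := fun j => by
      rw [hT j]
      ring
    rw [h1, Binf_eq, map_add, map_mul, hC, map_sum, Matrix.sub_apply, map_sub, hone,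
      Fin.sum_univ_succ, Matrix.add_apply, map_add, Matrix.sum_apply, map_sum]
    simp only [map_mul, hC, hres, h2, Finset.sum_add_distrib, ← Finset.mul_sum]
    ring
  simp only [Matrix.mulVec, dotProduct, Matrix.map_apply, hA, add_mul, sub_mul,
    Finset.sum_add_distrib, Finset.sum_sub_distrib, blockSum, Fintype.sum_prod_type,
    Fin.sum_univ_succ, param_zero, param_succ]
  have h3 : ∑ l, φ E.T * (1 : Matrix n n R) k l * z l = φ E.T * z k := by
    rw [Finset.sum_eq_single k]
    · simp
    · intro l _ hl
      simp [Matrix.one_apply_ne hl.symm]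
    · simp
  have h4 : ∑ l, (∑ j : Fin N, algebraMap ℂ R (E.b j)⁻¹ * φ X * φ (E.Tdel j) *
        algebraMap ℂ R (E.res j.succ k l)) * z l = -∑ j : Fin N, ∑ l,
          algebraMap ℂ R (E.res j.succ k l) *
            (-(algebraMap ℂ R (E.b j)⁻¹ * φ X * φ (E.Tdel j)) * z l) := by
    simp only [Finset.sum_mul]
    rw [Finset.sum_comm, ← Finset.sum_neg_distrib]
    refine Finset.sum_congr rfl fun j _ => ?_
    rw [← Finset.sum_neg_distrib]
    exact Finset.sum_congr rfl fun l _ => by ring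
  have h5 : ∑ l, φ E.T * algebraMap ℂ R (E.res 0 k l) * z l =
      ∑ l, algebraMap ℂ R (E.res 0 k l) * (φ E.T * z l) :=
    Finset.sum_congr rfl fun l _ => by ring
  rw [h3, h4, h5]
  ring

theorem mem_ker_core_iff (E : System n N) (y : R) (w : Fin (N + 1) × n → R) :
    (E.core y).mulVec w = 0 ↔ (∀ k, w (0, k) = E.blockSum w k) ∧ ∀ (i : Fin N) k,
      (1 - algebraMap ℂ R (E.b i)⁻¹ * y) * w (i.succ, k) +
        algebraMap ℂ R (E.b i)⁻¹ * y * E.blockSum w k = 0 := by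
  simp only [funext_iff, core_mulVec, Prod.forall, Fin.forall_fin_succ, Pi.zero_apply, diagCoeff,
    rowCoeff, Fin.cons_zero, Fin.cons_succ, one_mul, neg_mul, ← sub_eq_add_neg, sub_eq_zero]

/-- A kernel vector satisfies `(1 - y/b_i) w_i = -(y/b_i) w_0`, which forces `w = param z`; the
remaining equation is then `A z = 0`. Since `T` may be a zero divisor in `R`, the vector `z` is
recovered by a Bézout relation instead of by division. -/
theorem finrank_ker_core (E : System n N) (φ : ℂ[X] →ₐ[ℂ] R) :
    Module.finrank ℂ (LinearMap.ker ((E.core (φ X)).mulVecLin.restrictScalars ℂ)) =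
      Module.finrank ℂ (LinearMap.ker ((E.A.map φ).mulVecLin.restrictScalars ℂ)) := by
  obtain ⟨p₀, p, hp⟩ := E.exists_bezout
  have hC : ∀ z : ℂ, φ (C z) = algebraMap ℂ R z := fun z => φ.commutes z
  have hb : ∀ j, algebraMap ℂ R (E.b j) * algebraMap ℂ R (E.b j)⁻¹ = 1 := fun j => by
    rw [← map_mul, mul_inv_cancel₀ (E.b_ne_zero j), map_one]
  have hT : ∀ j, φ E.T = (1 - algebraMap ℂ R (E.b j)⁻¹ * φ X) * φ (E.Tdel j) := fun j => by
    rw [T_eq E j, map_mul, map_sub, map_mul, map_one, hC]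
  have hbez : φ p₀ * φ E.T + ∑ j, φ (p j) * (φ X * φ (E.Tdel j)) = 1 := by
    rw [← map_one φ, ← hp, map_add, map_sum]
    simp only [map_mul]
  -- The factor `b_j` cancels the `b_j⁻¹` in `param`, so that `ret ∘ param` is multiplication by the
  -- Bézout sum.
  let ret : (Fin (N + 1) × n → R) → n → R := fun w k =>
    φ p₀ * w (0, k) - ∑ j : Fin N, φ (p j) * algebraMap ℂ R (E.b j) * w (j.succ, k)
  have hret : Function.LeftInverse ret (E.param φ) := fun z => by
    ext k
    simp only [ret, param_zero, param_succ]
    have h1 : ∀ j, φ (p j) * algebraMap ℂ R (E.b j) *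
        (-(algebraMap ℂ R (E.b j)⁻¹ * φ X * φ (E.Tdel j)) * z k) =
          -(φ (p j) * (φ X * φ (E.Tdel j)) * z k) := fun j => by
      linear_combination (-φ (p j) * φ X * φ (E.Tdel j) * z k) * hb j
    simp only [h1, Finset.sum_neg_distrib, ← Finset.sum_mul]
    linear_combination z k * hbez
  have hmap : LinearMap.ker ((E.core (φ X)).mulVecLin.restrictScalars ℂ) =
      (LinearMap.ker ((E.A.map φ).mulVecLin.restrictScalars ℂ)).map (E.param φ) := by
    ext w
    rw [LinearMap.mem_ker, Submodule.mem_map]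
    change (E.core (φ X)).mulVec w = 0 ↔ ∃ z, (E.A.map φ).mulVec z = 0 ∧ E.param φ z = w
    constructor
    · intro hw
      rw [mem_ker_core_iff] at hw
      obtain ⟨hw0, hwi⟩ := hw
      have hpar : E.param φ (ret w) = w := by
        ext ⟨j, k⟩
        have hwi' : ∀ i : Fin N, algebraMap ℂ R (E.b i) * w (i.succ, k) =
            φ X * w (i.succ, k) - φ X * w (0, k) := fun i => by
          have h1 := hwi i k
          rw [← hw0 k] at h1
          linear_combination algebraMap ℂ R (E.b i) * h1 +
            (φ X * w (i.succ, k) - φ X * w (0, k)) * hb i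
        have hTw : ∀ i : Fin N, φ E.T * algebraMap ℂ R (E.b i) * w (i.succ, k) =
            -(φ X * φ (E.Tdel i) * w (0, k)) := fun i => by
          rw [hT i]
          linear_combination φ (E.Tdel i) * hwi' i - φ (E.Tdel i) * φ X * w (i.succ, k) * hb i
        induction j using Fin.cases with
        | zero =>
          rw [param_zero]
          simp only [ret, mul_sub, Finset.mul_sum]
          have h2 : ∀ j : Fin N, φ E.T * (φ (p j) * algebraMap ℂ R (E.b j) * w (j.succ, k)) =
              -(φ (p j) * (φ X * φ (E.Tdel j)) * w (0, k)) := fun j => by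
            linear_combination φ (p j) * hTw j
          simp only [h2, Finset.sum_neg_distrib, ← Finset.sum_mul]
          linear_combination w (0, k) * hbez
        | succ i =>
          rw [param_succ]
          simp only [ret, mul_sub, Finset.mul_sum]
          -- `T_i` and `T_j` share a factor `u`, and `(1 - x/b_j) b_j w_j` equals `-x w_0` for every
          -- `j`.
          have h3 : ∀ j : Fin N, φ X * φ (E.Tdel i) * algebraMap ℂ R (E.b j) * w (j.succ, k) =
              φ X * φ (E.Tdel j) * algebraMap ℂ R (E.b i) * w (i.succ, k) := fun j => by
            by_cases hij : i = j
            · rw [hij]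
            · obtain ⟨u, hu1, hu2⟩ := E.exists_Tdel_factor hij
              rw [hu1, hu2]
              simp only [map_mul, map_sub, map_one, hC]
              linear_combination φ X * φ u * hwi' j - φ X * φ u * hwi' i
                - φ X * φ u * φ X * w (j.succ, k) * hb j + φ X * φ u * φ X * w (i.succ, k) * hb i
          have h4 : ∀ j : Fin N, -(algebraMap ℂ R (E.b i)⁻¹ * φ X * φ (E.Tdel i)) *
              (φ (p j) * algebraMap ℂ R (E.b j) * w (j.succ, k)) =
                -(φ (p j) * (φ X * φ (E.Tdel j)) * w (i.succ, k)) := fun j => by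
            linear_combination -algebraMap ℂ R (E.b i)⁻¹ * φ (p j) * h3 j -
              φ (p j) * (φ X * φ (E.Tdel j)) * w (i.succ, k) * hb i
          simp only [h4, Finset.sum_neg_distrib, ← Finset.sum_mul]
          linear_combination w (i.succ, k) * hbez - algebraMap ℂ R (E.b i)⁻¹ * φ p₀ * hTw i +
            φ p₀ * φ E.T * w (i.succ, k) * hb i
      refine ⟨ret w, ?_, hpar⟩
      ext k
      rw [A_mulVec, hpar, hw0 k, sub_self]
      rfl
    · rintro ⟨z, hz, rfl⟩
      have h0 : ∀ k, E.param φ z (0, k) = E.blockSum (E.param φ z) k := fun k => by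
        rw [← sub_eq_zero, ← A_mulVec, hz]
        rfl
      rw [mem_ker_core_iff]
      refine ⟨h0, fun i k => ?_⟩
      rw [← h0 k, param_succ, param_zero, hT i]
      ring
  rw [hmap]
  exact (Submodule.equivMapOfInjective (E.param φ) hret.injective _).finrank_eq.symm

end Factor

end System

namespace System

variable {n : Type} {N : ℕ}

/-! ### Orders of the row factors at the points `b_i` -/

theorem eval_rowFactor_ne_zero (E : System n N) {c a : ℂ} (hc : c ≠ 0) (h : ∀ i, a ≠ E.b i)
    (l : Fin (N + 1)) : (E.rowFactor c l).eval a ≠ 0 := by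
  induction l using Fin.cases with
  | zero =>
    change E.T.eval a ≠ 0
    rw [Ne, eval_T_eq_zero_iff]
    exact fun ⟨i, hi⟩ => h i hi
  | succ i =>
    change (C c * E.Tdel i).eval a ≠ 0
    rw [eval_mul, eval_C]
    exact mul_ne_zero hc (E.eval_Tdel_ne_zero fun j _ => h j)

theorem eval_Tdel_self_ne_zero (E : System n N) (i : Fin N) : (E.Tdel i).eval (E.b i) ≠ 0 :=
  E.eval_Tdel_ne_zero fun _ hj e => hj (E.b_injective e.symm)

theorem eval_rowFactor_succ_ne_zero (E : System n N) {c : ℂ} (hc : c ≠ 0) (i : Fin N) :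
    (E.rowFactor c i.succ).eval (E.b i) ≠ 0 := by
  change (C c * E.Tdel i).eval (E.b i) ≠ 0
  rw [eval_mul, eval_C]
  exact mul_ne_zero hc (E.eval_Tdel_self_ne_zero i)

theorem exists_rowFactor_eq_mul (E : System n N) {c : ℂ} (hc : c ≠ 0) {i : Fin N} {l : Fin (N + 1)}
    (hl : l ≠ i.succ) :
    ∃ u : ℂ[X], E.rowFactor c l = (X - C (E.b i)) * u ∧ u.eval (E.b i) ≠ 0 := by
  have hb := E.b_ne_zero i
  have hfac : (1 - C (E.b i)⁻¹ * X : ℂ[X]) = (X - C (E.b i)) * -C (E.b i)⁻¹ := by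
    have h1 : (C (E.b i) * C (E.b i)⁻¹ : ℂ[X]) = 1 := by
      rw [← C_mul, mul_inv_cancel₀ hb, C_1]
    linear_combination -h1
  induction l using Fin.cases with
  | zero =>
    refine ⟨-C (E.b i)⁻¹ * E.Tdel i, ?_, ?_⟩
    · change E.T = _
      rw [T_eq E i, hfac, mul_assoc]
    · rw [eval_mul, eval_neg, eval_C]
      exact mul_ne_zero (neg_ne_zero.mpr (inv_ne_zero hb)) (E.eval_Tdel_self_ne_zero i)
  | succ k =>
    obtain ⟨u, hu1, hu2⟩ := E.exists_Tdel_factor (i := i) (j := k) fun e => hl (by rw [e])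
    have hu : u.eval (E.b i) ≠ 0 := fun h0 => E.eval_Tdel_self_ne_zero i (by
      rw [hu1, eval_mul, h0, mul_zero])
    refine ⟨C c * -C (E.b i)⁻¹ * u, ?_, ?_⟩
    · change C c * E.Tdel k = _
      rw [hu2, hfac]
      ring
    · rw [eval_mul, eval_mul, eval_neg, eval_C, eval_C]
      exact mul_ne_zero (mul_ne_zero hc (neg_ne_zero.mpr (inv_ne_zero hb))) hu

variable [Fintype n]

theorem card_sub_card : Fintype.card (Fin (N + 1) × n) - Fintype.card n = N * Fintype.card n := by
  rw [Fintype.card_prod, Fintype.card_fin, add_mul, one_mul, Nat.add_sub_cancel]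

variable [DecidableEq n]

theorem blockRow_mulVec_apply (E : System n N) (i : Fin (N + 1)) (τ : ℂ)
    (v : Fin (N + 1) × n → ℂ) (k : n) :
    (E.blockRow i τ).mulVec v k = E.blockSum v k + τ * v (i, k) := by
  rw [blockRow_mulVec]
  simp [blockSum, Matrix.mulVec, dotProduct, Fintype.sum_prod_type]

/-! ### The nullities of the convolution over truncated polynomial rings -/

/-- The substitution `X ↦ X/c` identifies the truncated ring at `a` with the one at `c a`, and
`finrank_ker_core` applies along it. -/
theorem finrank_ker_core_trunc (E : System n N) {c : ℂ} (hc : c ≠ 0) (a : ℂ) (j : ℕ) :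
    Module.finrank ℂ (LinearMap.ker ((E.core
      (c⁻¹ • Ideal.Quotient.mk (Ideal.span {(X - C (c * a)) ^ j}) X :
        Trunc (c * a) j)).mulVecLin.restrictScalars ℂ)) = divNullity E.A a j := by
  obtain ⟨σ, hσ⟩ := exists_truncScale hc a j
  let φ : ℂ[X] →ₐ[ℂ] Trunc (c * a) j := σ.toAlgHom.comp (Ideal.Quotient.mkₐ ℂ _)
  have hφ : φ X = c⁻¹ • Ideal.Quotient.mk (Ideal.span {(X - C (c * a)) ^ j}) X := hσ
  rw [← hφ, finrank_ker_core, divNullity]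
  refine (finrank_ker_eq_of_conj (LinearEquiv.piCongrRight fun _ => σ.toLinearEquiv)
    (LinearEquiv.piCongrRight fun _ => σ.toLinearEquiv) fun x => ?_).symm
  ext k
  exact RingHom.map_mulVec (σ : Trunc a j →+* Trunc (c * a) j)
    (E.A.map (Ideal.Quotient.mk (Ideal.span {(X - C a) ^ j}))) x k

theorem conv_A_trunc_mulVec (E : System n N) {q lam : ℂ} (hc : q ^ lam ≠ 0) (a : ℂ) (j : ℕ)
    (w : Fin (N + 1) × n → Trunc a j) (s : Fin (N + 1) × n) :
    ((E.conv q lam).A.map (Ideal.Quotient.mk (Ideal.span {(X - C a) ^ j}))).mulVec w s =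
      Ideal.Quotient.mk (Ideal.span {(X - C a) ^ j}) (E.rowFactor (q ^ lam) s.1) *
        (E.core ((q ^ lam)⁻¹ • Ideal.Quotient.mk (Ideal.span {(X - C a) ^ j}) X :
          Trunc a j)).mulVec w s := by
  refine E.conv_A_mulVec (Ideal.Quotient.mkₐ ℂ (Ideal.span {(X - C a) ^ j})) ?_ w s
  rw [smul_smul, mul_inv_cancel₀ hc, one_smul]
  rfl

theorem divNullity_conv_of_ne (E : System n N) {q lam : ℂ} (hc : q ^ lam ≠ 0) {a : ℂ}
    (h : ∀ i, E.b i ≠ q ^ lam * a) (j : ℕ) :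
    divNullity (E.conv q lam).A (q ^ lam * a) j = divNullity E.A a j := by
  rw [← E.finrank_ker_core_trunc hc, divNullity]
  refine congrArg (fun p : Submodule ℂ (Fin (N + 1) × n → Trunc (q ^ lam * a) j) =>
    Module.finrank ℂ p) (Submodule.ext fun w => ?_)
  rw [LinearMap.mem_ker, LinearMap.mem_ker]
  change ((E.conv q lam).A.map _).mulVec w = 0 ↔ (E.core _).mulVec w = 0
  simp only [funext_iff, E.conv_A_trunc_mulVec hc, Pi.zero_apply]
  refine forall_congr' fun s => ?_
  exact (isUnit_trunc_mk (E.eval_rowFactor_ne_zero hc (fun i => (h i).symm) s.1) j).mul_right_eq_zero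

/-- The vectors over `ℂ[X] / (X - a) ^ (j + 1)` that vanish modulo `(X - a) ^ j`. -/
def topEmb (κ : Type) (a : ℂ) (j : ℕ) : (κ → ℂ) →ₗ[ℂ] (κ → Trunc a (j + 1)) :=
  (LinearMap.toSpanSingleton ℂ (Trunc a (j + 1)) (truncTop a j)).compLeft κ

theorem topEmb_apply {κ : Type} (a : ℂ) (j : ℕ) (v : κ → ℂ) (t : κ) :
    topEmb κ a j v t = v t • truncTop a j := rfl

/-- On multiples of `(X - b_i)^j` the variable acts as `b_i`, so `y` acts as `c⁻¹` times `b_i`, and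
row `i` of `core` becomes `(1 - c⁻¹) e_i + c⁻¹ B`, with `B = (B_0 … B_N)`. -/
theorem core_mulVec_topEmb (E : System n N) {c : ℂ} (hc : c ≠ 0) {a : ℂ} {i : Fin N}
    (hi : E.b i = a) (j : ℕ) (v : Fin (N + 1) × n → ℂ) (k : n) :
    (E.core (c⁻¹ • Ideal.Quotient.mk (Ideal.span {(X - C a) ^ (j + 1)}) X :
      Trunc a (j + 1))).mulVec (topEmb _ a j v) (i.succ, k) =
        (c⁻¹ * (E.blockRow i.succ (c - 1)).mulVec v k) • truncTop a j := by
  have hb := E.b_ne_zero i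
  have hX := mk_mul_truncTop a j X
  rw [eval_X] at hX
  have hsum : E.blockSum (topEmb _ a j v) k = E.blockSum v k • truncTop a j := by
    simp only [blockSum, topEmb_apply, Finset.sum_smul, Algebra.algebraMap_self, RingHom.id_apply]
    exact Finset.sum_congr rfl fun t _ => by rw [← Algebra.smul_def, smul_smul]
  rw [core_mulVec, hsum, topEmb_apply, blockRow_mulVec_apply]
  simp only [diagCoeff, rowCoeff, Fin.cons_succ, ← Algebra.smul_def, sub_mul, one_mul,
    smul_mul_assoc, mul_smul_comm, hX]
  rw [← hi]
  match_scalars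
  field_simp
  ring

theorem divNullity_conv_of_eq (E : System n N) (hE : E.StarStar) {q lam : ℂ} (hc : q ^ lam ≠ 0)
    {a : ℂ} {i : Fin N} (hi : E.b i = q ^ lam * a) (j : ℕ) :
    divNullity (E.conv q lam).A (q ^ lam * a) (j + 1) =
      N * Fintype.card n + divNullity E.A a j := by
  rw [← E.finrank_ker_core_trunc hc, divNullity]
  set c := q ^ lam with hcdef
  set y : Trunc (c * a) (j + 1) :=
    c⁻¹ • Ideal.Quotient.mk (Ideal.span {(X - C (c * a)) ^ (j + 1)}) X with hy
  set y' : Trunc (c * a) j := c⁻¹ • Ideal.Quotient.mk (Ideal.span {(X - C (c * a)) ^ j}) X with hy'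
  have hyy' : truncRed (c * a) j y = y' := by
    rw [hy, map_smul, truncRed_mk]
  set W := LinearMap.ker (((E.conv q lam).A.map (Ideal.Quotient.mk
    (Ideal.span {(X - C (c * a)) ^ (j + 1)}))).mulVecLin.restrictScalars ℂ) with hW
  set K := LinearMap.ker ((E.core y').mulVecLin.restrictScalars ℂ) with hK
  let red : (Fin (N + 1) × n → Trunc (c * a) (j + 1)) →ₗ[ℂ] (Fin (N + 1) × n → Trunc (c * a) j) :=
    (truncRed (c * a) j).toLinearMap.compLeft _
  have hcore : ∀ w s, truncRed (c * a) j ((E.core y).mulVec w s) =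
      (E.core y').mulVec (red w) s := fun w s => by
    rw [← hyy', ← core_map]
    exact RingHom.map_mulVec (truncRed (c * a) j : _ →+* Trunc (c * a) j) (E.core y) w s
  have hmemK : ∀ w', w' ∈ K ↔ (E.core y').mulVec w' = 0 := fun _ => Iff.rfl
  -- Row `i` has a unit factor and is imposed in full; each other row has a factor with a simple
  -- zero and is imposed one order lower.
  have hmemW : ∀ w, w ∈ W ↔ (∀ k, (E.core y).mulVec w (i.succ, k) = 0) ∧ red w ∈ K := fun w => by
    have h1 : w ∈ W ↔ ∀ s : Fin (N + 1) × n, Ideal.Quotient.mk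
        (Ideal.span {(X - C (c * a)) ^ (j + 1)}) (E.rowFactor c s.1) *
          (E.core y).mulVec w s = 0 := by
      rw [hW, LinearMap.mem_ker]
      change ((E.conv q lam).A.map _).mulVec w = 0 ↔ _
      simp only [funext_iff, E.conv_A_trunc_mulVec hc, Pi.zero_apply]
      rfl
    have hunit : ∀ k, Ideal.Quotient.mk (Ideal.span {(X - C (c * a)) ^ (j + 1)})
        (E.rowFactor c i.succ) * (E.core y).mulVec w (i.succ, k) = 0 ↔
          (E.core y).mulVec w (i.succ, k) = 0 := fun k => by
      have h2 := E.eval_rowFactor_succ_ne_zero hc i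
      rw [hi] at h2
      exact (isUnit_trunc_mk h2 _).mul_right_eq_zero
    have hother : ∀ l k, l ≠ i.succ → (Ideal.Quotient.mk (Ideal.span {(X - C (c * a)) ^ (j + 1)})
        (E.rowFactor c l) * (E.core y).mulVec w (l, k) = 0 ↔
          (E.core y').mulVec (red w) (l, k) = 0) := fun l k hl => by
      obtain ⟨u, hu, hu0⟩ := E.exists_rowFactor_eq_mul hc hl
      rw [hi] at hu hu0
      rw [← hcore, hu]
      exact mk_mul_eq_zero_iff hu0 _
    rw [h1, hmemK, funext_iff]
    constructor
    · intro h
      have hrow : ∀ k, (E.core y).mulVec w (i.succ, k) = 0 := fun k => (hunit k).mp (h _)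
      refine ⟨hrow, ?_⟩
      rintro ⟨l, k⟩
      by_cases hl : l = i.succ
      · rw [hl, ← hcore, hrow, map_zero]
        rfl
      · exact (hother l k hl).mp (h _)
    · rintro ⟨hrow, h⟩ ⟨l, k⟩
      by_cases hl : l = i.succ
      · rw [hl, hrow, mul_zero]
      · exact (hother l k hl).mpr (h _)
  have hredtop : ∀ v, red (topEmb _ (c * a) j v) = 0 := fun v => by
    ext t
    change truncRed (c * a) j (v t • truncTop (c * a) j) = 0
    rw [map_smul, truncRed_truncTop, smul_zero]
  have hmap : W.map red = K := by
    ext w'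
    rw [Submodule.mem_map]
    constructor
    · rintro ⟨w, hw, rfl⟩
      exact ((hmemW w).mp hw).2
    · intro hw'
      choose w hw using fun t => truncRed_surjective (c * a) j (w' t)
      have hredw : red w = w' := funext hw
      have hr : ∀ k, ∃ r : ℂ, (E.core y).mulVec w (i.succ, k) = r • truncTop (c * a) j := fun k => by
        refine exists_smul_truncTop ?_
        rw [hcore, hredw, (hmemK w').mp hw']
        rfl
      choose r hr using hr
      -- An arbitrary lift fails row `i` only by a top-order term `r`. A correction `v` changes that
      -- term by `c⁻¹` times the block row applied to `v`, hence the target `-(c • r)`.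
      obtain ⟨v, hv⟩ := hE.blockRow_surjective i.succ (c - 1) (-(c • r))
      have hred : red (w + topEmb _ (c * a) j v) = w' := by
        rw [map_add, hredtop, add_zero, hredw]
      refine ⟨w + topEmb _ (c * a) j v, (hmemW _).mpr ⟨fun k => ?_, hred ▸ hw'⟩, hred⟩
      rw [Matrix.mulVec_add, Pi.add_apply, hr, E.core_mulVec_topEmb hc hi, ← add_smul, hv]
      simp [hc]
  have htop_inj : Function.Injective (topEmb (Fin (N + 1) × n) (c * a) j) := by
    rw [injective_iff_map_eq_zero]
    intro v hv
    ext t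
    exact smul_truncTop_eq_zero (congrFun hv t)
  have hker : W ⊓ LinearMap.ker red =
      (LinearMap.ker (E.blockRow i.succ (c - 1)).mulVecLin).map (topEmb _ (c * a) j) := by
    ext w
    rw [Submodule.mem_inf, Submodule.mem_map]
    constructor
    · rintro ⟨hw, hred⟩
      choose v hv using fun t => exists_smul_truncTop (congrFun (LinearMap.mem_ker.mp hred) t)
      have hvw : topEmb _ (c * a) j v = w := (funext hv).symm
      refine ⟨v, ?_, hvw⟩
      rw [LinearMap.mem_ker]
      ext k
      have h1 := ((hmemW w).mp hw).1 k
      rw [← hvw, E.core_mulVec_topEmb hc hi] at h1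
      exact (mul_eq_zero.mp (smul_truncTop_eq_zero h1)).resolve_left (inv_ne_zero hc)
    · rintro ⟨v, hv, rfl⟩
      refine ⟨(hmemW _).mpr ⟨fun k => ?_, ?_⟩, hredtop v⟩
      · have h1 : (E.blockRow i.succ (c - 1)).mulVec v = 0 := hv
        rw [E.core_mulVec_topEmb hc hi, h1, Pi.zero_apply, mul_zero, zero_smul]
      · rw [hredtop]
        exact zero_mem K
  have hdim := LinearMap.finrank_range_add_finrank_ker (red.domRestrict W)
  rw [LinearMap.range_domRestrict, LinearMap.ker_domRestrict, hmap,
    (Submodule.equivSubtypeMap W (Submodule.comap W.subtype (LinearMap.ker red))).finrank_eq,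
    Submodule.map_comap_subtype, hker, ← (Submodule.equivMapOfInjective _ htop_inj _).finrank_eq]
    at hdim
  have hrow := LinearMap.finrank_range_add_finrank_ker (E.blockRow i.succ (c - 1)).mulVecLin
  rw [LinearMap.range_eq_top.mpr (hE.blockRow_surjective i.succ (c - 1)), finrank_top,
    Module.finrank_fintype_fun_eq_card, Module.finrank_fintype_fun_eq_card, Fintype.card_prod,
    Fintype.card_fin, add_mul, one_mul] at hrow
  rw [← hdim]
  omega

/-! ### Nonvanishing of the convolution -/

/-- At each `a` some row factor is nonzero, so `G(a) = 0` would annihilate that row of `core`. Up to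
a nonzero scalar this row is a block row, surjective by (∗∗): row `i` with `τ = c - 1` at `a = b_i`,
row `0` with `τ = -1` elsewhere. -/
theorem conv_A_map_eval_ne_zero (E : System n N) [Nonempty n] (hE : E.StarStar) {q lam : ℂ}
    (hc : q ^ lam ≠ 0) (a : ℂ) : (E.conv q lam).A.map (eval a) ≠ 0 := by
  intro h0
  set c := q ^ lam with hcdef
  have hy : (aeval a : ℂ[X] →ₐ[ℂ] ℂ) X = c • (c⁻¹ * a) := by
    rw [aeval_X, smul_eq_mul, mul_inv_cancel_left₀ hc]
  have hzero : ∀ (l : Fin (N + 1)), (E.rowFactor c l).eval a ≠ 0 →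
      ∀ (w : Fin (N + 1) × n → ℂ) (k : n), (E.core (c⁻¹ * a)).mulVec w (l, k) = 0 :=
    fun l hl w k => by
      have h1 := E.conv_A_mulVec (aeval a) hy w (l, k)
      rw [coe_aeval_eq_eval, h0, Matrix.zero_mulVec, Pi.zero_apply] at h1
      exact (mul_eq_zero.mp h1.symm).resolve_left hl
  obtain ⟨k⟩ := ‹Nonempty n›
  by_cases ha : ∃ i, a = E.b i
  · obtain ⟨i, rfl⟩ := ha
    obtain ⟨w, hw⟩ := hE.blockRow_surjective i.succ (c - 1) 1
    have h1 := hzero i.succ (E.eval_rowFactor_succ_ne_zero hc i) w k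
    have h2 := congrFun hw k
    rw [blockRow_mulVec_apply, Pi.one_apply] at h2
    rw [core_mulVec] at h1
    simp only [diagCoeff, rowCoeff, Fin.cons_succ, Algebra.algebraMap_self, RingHom.id_apply] at h1
    have hb := E.b_ne_zero i
    field_simp at h1
    exact one_ne_zero (h2.symm.trans (by linear_combination h1))
  · push Not at ha
    obtain ⟨w, hw⟩ := hE.blockRow_surjective 0 (-1) 1
    have h1 := hzero 0 (E.eval_rowFactor_ne_zero hc ha 0) w k
    have h2 := congrFun hw k
    rw [blockRow_mulVec_apply, Pi.one_apply] at h2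
    rw [core_mulVec] at h1
    simp only [diagCoeff, rowCoeff, Fin.cons_zero] at h1
    exact one_ne_zero (h2.symm.trans (by linear_combination -h1))

/-! ### Nonvanishing of the determinant; injectivity and surjectivity of the factors -/

theorem det_A_ne_zero (E : System n N) (h : IsUnit E.Azero) : E.A.det ≠ 0 := fun h0 => by
  have h1 : E.Azero = (evalRingHom 0).mapMatrix E.A := by
    ext k l
    simp [Azero, coeff_zero_eq_eval_zero]
  have h2 : E.Azero.det = 0 := by
    rw [h1, ← RingHom.map_det, h0, map_zero]
  exact ((Matrix.isUnit_iff_isUnit_det _).mp h).ne_zero h2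

theorem StarStar.neg_blockRow_surjective {E : System n N} (hE : E.StarStar) (τ : ℂ) :
    Function.Surjective (-E.blockRow 0 τ).mulVec := fun x => by
  obtain ⟨w, hw⟩ := hE.blockRow_surjective 0 τ (-x)
  exact ⟨w, by rw [Matrix.neg_mulVec, hw, neg_neg]⟩

theorem StarStar.smul_blockRow_surjective {E : System n N} (hE : E.StarStar) {z : ℂ} (hz : z ≠ 0) :
    Function.Surjective (z • E.blockRow 0 0).mulVec := fun x => by
  obtain ⟨w, hw⟩ := hE.blockRow_surjective 0 0 (z⁻¹ • x)
  exact ⟨w, by rw [Matrix.smul_mulVec, hw, smul_inv_smul₀ hz]⟩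

theorem headEmb_injective : Function.Injective (headEmb n N).mulVec := fun x y h => by
  ext k
  have h1 := congrFun h (0, k)
  simpa [headEmb, Matrix.mulVec, dotProduct] using h1

theorem diagEmb_injective : Function.Injective (diagEmb n N).mulVec := fun x y h => by
  ext k
  have h1 := congrFun h (0, k)
  simpa [diagEmb, Matrix.mulVec, dotProduct] using h1

end System

end QDiff

end

/-! ### The spectral type of the convolution -/

theorem proposition3 (m N : ℕ) (hm : 1 ≤ m) (hN : 1 ≤ N)
    (q lam : ℂ) (hq0 : 0 < ‖q‖) (hq1 : ‖q‖ < 1)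
    (E : QDiff.System (Fin m) N) (hE : E.IsFuchsian)
    (hstar : E.Star) (hstarstar : E.StarStar)
    (S : QDiff.SpectralType) (hS : E.HasSpectralType S) :
    (E.conv q lam).IsFuchsian ∧
    (∀ a : ℂ, (E.conv q lam).A.map (Polynomial.eval a) ≠ 0) ∧
    (E.conv q lam).HasSpectralType
      { zero := QDiff.adjoin (q ^ lam) (N * m) S.zero
        inf := QDiff.adjoin E.binf (N * m) S.inf
        div := QDiff.adjoinDiv E.b (q ^ lam) (N * m) S.div } := by
  have hc : q ^ lam ≠ 0 := by
    rw [Complex.cpow_def_of_ne_zero (norm_pos_iff.mp hq0)]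
    exact Complex.exp_ne_zero _
  have hne : Nonempty (Fin m) := ⟨⟨0, hm⟩⟩
  have hk : 1 ≤ N * m := Nat.mul_pos hN hm
  have hcard := QDiff.System.card_sub_card (n := Fin m) (N := N)
  have hcm : N * Fintype.card (Fin m) = N * m := by rw [Fintype.card_fin]
  have h0 : IsUnit (E.conv q lam).Azero := by
    rw [E.conv_Azero]
    exact QDiff.isUnit_add_mul_comm hc _ _ (E.Azero_eq_add_mul (q ^ lam) ▸ hE.1)
  have hinf : IsUnit (E.conv q lam).Ainf := by
    rw [E.conv_Ainf_eq_add_mul]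
    exact QDiff.isUnit_add_mul_comm E.binf_ne_zero _ _ (E.Ainf_eq_add_mul ▸ hE.2)
  refine ⟨⟨h0, hinf⟩, E.conv_A_map_eval_ne_zero hstarstar hc, ?_, ?_, ?_⟩
  -- Some spectral type exists by the Jordan form, and the nullities force it to be the predicted
  -- one. The other two components follow the same pattern.
  · obtain ⟨S', hS'⟩ := QDiff.exists_isMatrixSpectralType (E.conv q lam).Azero
    have heq : S' = QDiff.adjoin (q ^ lam) (N * m) S.zero := by
      refine QDiff.eq_adjoin hk hS.1.isSpectrum hS'.isSpectrum (fun j => ?_) fun α hα j => ?_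
      · rw [E.conv_Azero, E.Azero_eq_add_mul (q ^ lam), QDiff.nullity_add_mul_self _
          QDiff.System.headEmb_injective (hstarstar.neg_blockRow_surjective _), hcard, hcm]
      · rw [E.conv_Azero, E.Azero_eq_add_mul (q ^ lam), QDiff.nullity_add_mul_of_ne hα]
    exact heq ▸ hS'
  · obtain ⟨S', hS'⟩ := QDiff.exists_isMatrixSpectralType (E.conv q lam).Ainf
    have heq : S' = QDiff.adjoin E.binf (N * m) S.inf := by
      refine QDiff.eq_adjoin hk hS.2.1.isSpectrum hS'.isSpectrum (fun j => ?_) fun α hα j => ?_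
      · rw [E.conv_Ainf_eq_add_mul, E.Ainf_eq_add_mul, QDiff.nullity_add_mul_self _
          QDiff.System.diagEmb_injective
          (hstarstar.smul_blockRow_surjective (neg_ne_zero.mpr E.binf_ne_zero)), hcard, hcm]
      · rw [E.conv_Ainf_eq_add_mul, E.Ainf_eq_add_mul, QDiff.nullity_add_mul_of_ne hα]
    exact heq ▸ hS'
  · obtain ⟨S', hS'⟩ := QDiff.exists_isDivisorSpectralType (E.conv q lam).A
    have heq : S' = QDiff.adjoinDiv E.b (q ^ lam) (N * m) S.div := by
      refine QDiff.eq_adjoinDiv E.b_injective hc hk (hS.2.2.isSpectrum (E.det_A_ne_zero hE.1))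
        (hS'.isSpectrum ((E.conv q lam).det_A_ne_zero h0)) (fun a ha j => ?_) fun a ha j => ?_
      · obtain ⟨i, hi⟩ := ha
        rw [E.divNullity_conv_of_eq hstarstar hc hi, hcm]
      · exact E.divNullity_conv_of_ne hc (fun i hi => ha ⟨i, hi⟩) j
    exact heq ▸ hS'
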